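/- Theorem 1.3. Let $E\subset[0,1]^2$, let $\alpha>1$, and let $\mu$ be a Frostman measure of dimension $\alpha$ on $E$, that is, a Borel measure on $\mathbb R^2$ with $\mu(\mathbb R^2\setminus E)=0$ for which there is a constant $C<\infty$ with $$\mu(\{x: |x-y|\le r\})\le C r^{\alpha}\qquad\text{for all } y\in\mathbb R^2,\ r>0 .$$ Put $\widehat\mu(\xi)=\int e^{-2\pi i x\cdot\xi}\,d\mu(x)$. For $a=(a_1,a_2)$, $\phi\in\mathbb R$ and $\omega=(\omega_1,\omega_2)\in S^1$ let $$\omega_{a,\phi}=\rho_\phi(a_1\omega_1,a_2\omega_2),$$ where $\rho_\phi$ is the rotation of the plane by the angle $\phi$; thus $\omega\mapsto\omega_{a,\phi}$ is the standard parametrization of the ellipse with semi-axes $a_1,a_2$ rotated by $\phi$. Let $\psi:\mathbb R^2\to\mathbb R$ be a smooth function that is identically $1$ on $[1,2]^2$ and vanishes outside $[1/2,4]^2$. Then $$\int_0^{\pi}\int_{\mathbb R^2}\int_1^{\infty}\left(\int_{S^1}|\widehat\mu(t\,\omega_{a,\phi})|^2\,d\omega\right)^2 t\,dt\;|\psi(a)|\,da\,d\phi<\infty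 ,$$ where $d\omega$ is arc length on the unit circle. (For a nonnegative cutoff $\psi$ one has $|\psi(a)|=\psi(a)$.) -/

import Mathlib

open MeasureTheory
open scoped ENNReal NNReal

noncomputable section

namespace MattilaEllipse

/-- The Euclidean plane. -/
abbrev Plane : Type := EuclideanSpace ℝ (Fin 2)

/-- The closed unit square `[0,1]^2`. -/
def unitSquare : Set Plane := {x | ∀ i, x i ∈ Set.Icc (0 : ℝ) 1}

/-- `μ` is a Frostman measure of dimension `α` on `E`: it is carried by `E` and there is a finite
constant `C` with `μ {x | |x - y| ≤ r} ≤ C r ^ α` for every centre `y` and every radius `r > 0`. -/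
structure IsFrostman (μ : Measure Plane) (E : Set Plane) (α : ℝ) : Prop where
  carried : μ Eᶜ = 0
  growth : ∃ C : ℝ≥0, ∀ (y : Plane) (r : ℝ), 0 < r →
    μ (Metric.closedBall y r) ≤ ENNReal.ofReal (C * r ^ α)

/-- The Fourier transform `ξ ↦ ∫ exp (-2 π i x · ξ) dμ(x)` of a measure on the plane. -/
def fourierMeasure (μ : Measure Plane) (ξ : Plane) : ℂ :=
  ∫ x, Complex.exp (-(2 * Real.pi * inner ℝ x ξ : ℝ) * Complex.I) ∂μ

/-- The point of the unit circle at angle `θ`. -/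
def circlePoint (θ : ℝ) : Plane := !₂[Real.cos θ, Real.sin θ]

/-- The anisotropic dilation `(x₁, x₂) ↦ (a₁ x₁, a₂ x₂)`. -/
def dilate (a : ℝ × ℝ) (x : Plane) : Plane := !₂[a.1 * x 0, a.2 * x 1]

/-- The rotation of the plane by the angle `φ`. -/
def rotate (φ : ℝ) (x : Plane) : Plane :=
  !₂[Real.cos φ * x 0 - Real.sin φ * x 1, Real.sin φ * x 0 + Real.cos φ * x 1]

/-- The image `ω_{a,φ}` of a point `ω = w` of the unit circle on the ellipse with semi-axes `a₁, a₂` rotated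
by `φ`. -/
def ellipsePoint (a : ℝ × ℝ) (φ : ℝ) (w : Plane) : Plane := rotate φ (dilate a w)

/-- The mean `∫_{S^1} |μ̂(t ω_{a,φ})|² dω`, where `dω` is the arc length on the unit circle,
i.e. Lebesgue measure in the angle. -/
def ellipseMean (μ : Measure Plane) (a : ℝ × ℝ) (φ t : ℝ) : ℝ≥0∞ :=
  ∫⁻ θ in Set.Ioc 0 (2 * Real.pi),
    ‖fourierMeasure μ (t • ellipsePoint a φ (circlePoint θ))‖ₑ ^ 2

/-- The integral `∫_1^∞ (∫_{S^1} |μ̂(t ω_{a,φ})|² dω)² t dt`. -/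
def mattilaIntegral (μ : Measure Plane) (a : ℝ × ℝ) (φ : ℝ) : ℝ≥0∞ :=
  ∫⁻ t in Set.Ioi (1 : ℝ), ellipseMean μ a φ t ^ 2 * ENNReal.ofReal t

end MattilaEllipse

end

open MeasureTheory
open scoped ENNReal NNReal

noncomputable section

namespace MattilaEllipse

/-! Expand the square as an integral over pairs of points of one ellipse and let `ξ`, with polar
coordinates `r`, `τ₁`, be the first point. Trading `t` for `r` leaves, up to constants, the integral
of `r |μ̂(ξ)|²` times the mean of `|μ̂|²` over the ellipse of shape `a`, `φ` through `ξ`. If the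
average of this mean over `a` and `φ` is `O(1/r)` (`exists_lintegral_ellipses_le`), the factor `r`
cancels and what remains is `∫∫ |μ̂|² dr dτ₁`, the high-frequency part of the 1-energy of `μ`,
finite because `α > 1` (`SquareFrostman.lintegral_power_circle_lt_top`).

For the average, the ellipse through `ξ` meets the direction `τ` at radius `r σ`. Moving the second
semi-axis moves `σ` with speed at least a constant times `D = |sin(τ₁ + τ - 2φ) sin(τ₁ - τ)|`, while
`|σ - 1| ≤ 64 D`. So averaging over `a` replaces the value at one point by the mean over a radial
segment of relative width about `D`. A shift of `φ` decouples the two factors: with `κ = |sin 2φ|`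
fixed and `τ` measured from `τ₁`, one has `D = κ |sin τ|`.

For `|τ| ≤ 1/r` the trivial bound on `|μ̂|` suffices. At `|τ|` about `x`, directions are grouped
into sectors of opening `√κ x` and relative radial width `κ x`; this parabolic ratio makes each
sector fit in a rectangle of comparable sides. By the uncertainty principle and the growth of `μ` on
dual rectangles, the integral of `|μ̂|²` over a rectangle with half sides `B ≤ A` is `O(A^(2-α)
B^ε)` for every `0 ≤ ε ≤ 1` (`exists_setLIntegral_power_le`). The sum over `x` converges if `ε < α -
1`, and the resulting power of `κ` is integrable in `φ` if `ε > (α - 1)/2`; the proof takes `ε = 3/4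
(α - 1)`. -/

/-- A measure on the unit square with mass at most `C` and `α`-dimensional growth with constant `C`,
where `1 < α ≤ 2`. -/
structure SquareFrostman (μ : Measure Plane) (α C : ℝ) : Prop where
  carried : ∀ᵐ x ∂μ, x ∈ unitSquare
  growth : ∀ (y : Plane) (r : ℝ), 0 < r → μ (Metric.closedBall y r) ≤ ENNReal.ofReal (C * r ^ α)
  mass : μ Set.univ ≤ ENNReal.ofReal C
  nonneg : 0 ≤ C
  one_lt : 1 < α
  le_two : α ≤ 2

theorem norm_sq_eq (x : Plane) : ‖x‖ ^ 2 = x 0 ^ 2 + x 1 ^ 2 := by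
  rw [EuclideanSpace.norm_sq_eq]; simp [Fin.sum_univ_two]

theorem SquareFrostman.isFiniteMeasure {μ : Measure Plane} {α C : ℝ} (h : SquareFrostman μ α C) :
    IsFiniteMeasure μ := ⟨h.mass.trans_lt ENNReal.ofReal_lt_top⟩

/-- Capping the exponent at 2 costs nothing: small radii only gain from a smaller exponent, and
radii above 1 are covered by the total mass. -/
theorem IsFrostman.exists_squareFrostman {μ : Measure Plane} {E : Set Plane} {α : ℝ}
    (hμ : IsFrostman μ E α) (hE : E ⊆ unitSquare) (hα : 1 < α) :
    ∃ C, SquareFrostman μ (min α 2) C := by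
  obtain ⟨C, hC⟩ := hμ.growth
  have hsub : E ⊆ Metric.closedBall 0 2 := by
    intro x hx
    have h := hE hx
    have h0 := h 0
    have h1 := h 1
    rw [mem_closedBall_zero_iff]
    have := norm_sq_eq x
    have hn := norm_nonneg x
    simp only [Set.mem_Icc] at h0 h1
    nlinarith [mul_nonneg h0.1 (sub_nonneg.2 h0.2), mul_nonneg h1.1 (sub_nonneg.2 h1.2)]
  have hmass : μ Set.univ ≤ ENNReal.ofReal (C * 2 ^ α) := by
    calc μ Set.univ = μ (E ∪ Eᶜ) := by rw [Set.union_compl_self]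
      _ ≤ μ E + μ Eᶜ := measure_union_le _ _
      _ = μ E := by rw [hμ.carried, add_zero]
      _ ≤ _ := (measure_mono hsub).trans (hC 0 2 two_pos)
  have hC0 : (0 : ℝ) ≤ C := C.2
  have h2 : (1 : ℝ) ≤ 2 ^ α := Real.one_le_rpow (by norm_num) (by linarith)
  -- The square lies in the ball of radius 2 about the origin, so this constant bounds the mass; it
  -- also dominates `C`.
  refine ⟨C * 2 ^ α, ?_, ?_, hmass, by positivity, lt_min hα (by norm_num), min_le_right _ _⟩
  · have : ∀ᵐ x ∂μ, x ∈ E := hμ.carried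
    exact this.mono fun x hx => hE hx
  · intro y r hr
    rcases le_total r 1 with h | h
    · refine (hC y r hr).trans (ENNReal.ofReal_le_ofReal ?_)
      have h3 : r ^ α ≤ r ^ (min α 2) :=
        Real.rpow_le_rpow_of_exponent_ge hr h (min_le_left _ _)
      have h4 : 0 ≤ r ^ (min α 2) := by positivity
      calc (C : ℝ) * r ^ α ≤ C * r ^ (min α 2) := by gcongr
        _ ≤ C * 2 ^ α * r ^ (min α 2) := by
          gcongr
          nlinarith
    · refine (measure_mono (Set.subset_univ _)).trans (hmass.trans (ENNReal.ofReal_le_ofReal ?_))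
      have h3 : 1 ≤ r ^ (min α 2) :=
        Real.one_le_rpow h (le_min (by linarith) (by norm_num))
      have : (0 : ℝ) ≤ C * 2 ^ α := by positivity
      nlinarith

/-! ### Mass of rectangles. -/

/-- The coordinate of `w` in the direction of angle `ζ`. -/
def alongCoord (ζ : ℝ) (w : Plane) : ℝ := w 0 * Real.cos ζ + w 1 * Real.sin ζ

/-- The coordinate of `w` orthogonal to the direction of angle `ζ`. -/
def acrossCoord (ζ : ℝ) (w : Plane) : ℝ := -(w 0) * Real.sin ζ + w 1 * Real.cos ζ

theorem alongCoord_sq_add_acrossCoord_sq (ζ : ℝ) (w : Plane) :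
    alongCoord ζ w ^ 2 + acrossCoord ζ w ^ 2 = ‖w‖ ^ 2 := by
  rw [norm_sq_eq, alongCoord, acrossCoord]
  linear_combination (w 0 ^ 2 + w 1 ^ 2) * Real.sin_sq_add_cos_sq ζ

@[fun_prop]
theorem continuous_alongCoord (ζ : ℝ) : Continuous (alongCoord ζ) := by
  unfold alongCoord; fun_prop

@[fun_prop]
theorem continuous_acrossCoord (ζ : ℝ) : Continuous (acrossCoord ζ) := by
  unfold acrossCoord; fun_prop

/-- The closed rectangle centred at `y` with half side `b` in the direction `ζ` and half side `a`
across it. -/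
def rectangle (ζ : ℝ) (y : Plane) (b a : ℝ) : Set Plane :=
  {x | |alongCoord ζ (x - y)| ≤ b ∧ |acrossCoord ζ (x - y)| ≤ a}

theorem measurableSet_rectangle (ζ : ℝ) (y : Plane) (b a : ℝ) :
    MeasurableSet (rectangle ζ y b a) := by
  have h1 : IsClosed {x | |alongCoord ζ (x - y)| ≤ b} := isClosed_le (by fun_prop) continuous_const
  have h2 : IsClosed {x | |acrossCoord ζ (x - y)| ≤ a} :=
    isClosed_le (by fun_prop) continuous_const
  exact (h1.inter h2).measurableSet

/-- About `b / a` balls of radius comparable to the short side `a` cover the rectangle, each of mass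
`O(a^α)`. -/
theorem SquareFrostman.measure_rectangle_le_of_le {μ : Measure Plane} {α C : ℝ}
    (h : SquareFrostman μ α C) (ζ : ℝ) (y : Plane) {a b : ℝ} (ha : 0 < a) (hab : a ≤ b) :
    μ (rectangle ζ y b a) ≤ ENNReal.ofReal (12 * C * a ^ (α - 1) * b) := by
  -- Centres are spaced by `a` along the long axis; a point is within `a` of the nearest lower one
  -- in each coordinate, hence within `2 * a`.
  set N := ⌊2 * b / a⌋₊ + 1 with hN
  let ctr : ℕ → Plane := fun k =>
    !₂[y 0 + (-b + k * a) * Real.cos ζ, y 1 + (-b + k * a) * Real.sin ζ]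
  have hcover : rectangle ζ y b a ⊆ ⋃ k ∈ Finset.range N, Metric.closedBall (ctr k) (2 * a) := by
    intro x hx
    obtain ⟨h1, h2⟩ := hx
    rw [abs_le] at h1
    set s := alongCoord ζ (x - y) with hs
    have hs0 : 0 ≤ (s + b) / a := div_nonneg (by linarith) ha.le
    simp only [Set.mem_iUnion, Finset.mem_range]
    refine ⟨⌊(s + b) / a⌋₊, ?_, ?_⟩
    · rw [hN, Nat.lt_succ_iff]
      apply Nat.floor_le_floor
      gcongr
      linarith
    · set k := ⌊(s + b) / a⌋₊ with hk
      have k1 : (k : ℝ) ≤ (s + b) / a := Nat.floor_le hs0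
      have k2 : (s + b) / a < k + 1 := Nat.lt_floor_add_one _
      rw [le_div_iff₀ ha] at k1
      rw [div_lt_iff₀ ha] at k2
      rw [mem_closedBall_iff_norm]
      have e1 : alongCoord ζ (x - ctr k) = s - (-b + k * a) := by
        simp only [alongCoord, ctr, hs, PiLp.sub_apply]
        simp
        linear_combination (-(-b + k * a)) * Real.sin_sq_add_cos_sq ζ
      have e2 : acrossCoord ζ (x - ctr k) = acrossCoord ζ (x - y) := by
        simp only [acrossCoord, ctr, PiLp.sub_apply]
        simp
        ring
      have e3 := alongCoord_sq_add_acrossCoord_sq ζ (x - ctr k)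
      rw [e1, e2] at e3
      have e4 : acrossCoord ζ (x - y) ^ 2 ≤ a ^ 2 := by
        rw [← sq_abs]; gcongr
      have e5 : (s - (-b + k * a)) ^ 2 ≤ a ^ 2 := by
        apply sq_le_sq'
        · linarith
        · linarith
      apply le_of_sq_le_sq _ (by positivity)
      nlinarith
  have hC := h.nonneg
  have hNb : (N : ℝ) ≤ 3 * b / a := by
    have : (⌊2 * b / a⌋₊ : ℝ) ≤ 2 * b / a := Nat.floor_le (by have := ha.trans_le hab; positivity)
    have h1 : 1 ≤ b / a := (one_le_div ha).2 hab
    rw [hN]; push_cast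
    calc (⌊2 * b / a⌋₊ : ℝ) + 1 ≤ 2 * b / a + b / a := by linarith
      _ = 3 * b / a := by ring
  calc μ (rectangle ζ y b a) ≤ ∑ k ∈ Finset.range N, μ (Metric.closedBall (ctr k) (2 * a)) :=
        (measure_mono hcover).trans (measure_biUnion_finset_le _ _)
    _ ≤ ∑ k ∈ Finset.range N, ENNReal.ofReal (C * (2 * a) ^ α) :=
        Finset.sum_le_sum fun k _ => h.growth _ _ (by positivity)
    _ = ENNReal.ofReal (N * (C * (2 * a) ^ α)) := by
        rw [Finset.sum_const, Finset.card_range, nsmul_eq_mul,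
          ENNReal.ofReal_mul (p := (N : ℝ)) (by positivity),
          ENNReal.ofReal_natCast]
    _ ≤ _ := by
        apply ENNReal.ofReal_le_ofReal
        have h2 : (2 : ℝ) ^ α ≤ 4 := by
          calc (2 : ℝ) ^ α ≤ 2 ^ (2 : ℝ) :=
                Real.rpow_le_rpow_of_exponent_le (by norm_num) h.le_two
            _ = 4 := by norm_num
        have h3 : a ^ α = a ^ (α - 1) * a := by
          rw [← Real.rpow_add_one ha.ne']; ring_nf
        rw [Real.mul_rpow (by norm_num) ha.le]
        calc (N : ℝ) * (C * (2 ^ α * a ^ α)) ≤ (3 * b / a) * (C * (4 * a ^ α)) := by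
                have := ha.trans_le hab
                gcongr
          _ = _ := by rw [h3]; field_simp; ring

/-- The square has diameter below 2, so the long side may be truncated at 2, and `min b 2 ≤ 2 * b ^
(1 - ε)`. The lost power of `b` becomes the gain `B ^ ε` on the Fourier side. -/
theorem SquareFrostman.measure_rectangle_le {μ : Measure Plane} {α C : ℝ}
    (h : SquareFrostman μ α C) (ζ : ℝ) {y : Plane} (hy : y ∈ unitSquare) {a b ε : ℝ} (ha : 0 < a)
    (hab : a ≤ b) (hε : 0 ≤ ε) (hε1 : ε ≤ 1) :
    μ (rectangle ζ y b a) ≤ ENNReal.ofReal (24 * C * a ^ (α - 1) * b ^ (1 - ε)) := by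
  have hC := h.nonneg
  have hα := h.one_lt
  have hb : 0 < b := ha.trans_le hab
  rcases le_or_gt a 2 with ha2 | ha2
  · have hm : 0 < min b 2 := lt_min hb two_pos
    have hle : μ (rectangle ζ y b a) ≤ μ (rectangle ζ y (min b 2) a) := by
      apply measure_mono_ae
      filter_upwards [h.carried] with x hx hxr
      refine ⟨le_min hxr.1 ?_, hxr.2⟩
      have e := alongCoord_sq_add_acrossCoord_sq ζ (x - y)
      rw [norm_sq_eq] at e
      have hx0 := hx 0
      have hx1 := hx 1
      have hy0 := hy 0
      have hy1 := hy 1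
      simp only [Set.mem_Icc] at hx0 hx1 hy0 hy1
      have e0 : ((x - y) 0) ^ 2 ≤ 1 := by
        simp only [PiLp.sub_apply]; apply sq_le_one_iff_abs_le_one _ |>.2; rw [abs_le]
        constructor <;> linarith
      have e1 : ((x - y) 1) ^ 2 ≤ 1 := by
        simp only [PiLp.sub_apply]; apply sq_le_one_iff_abs_le_one _ |>.2; rw [abs_le]
        constructor <;> linarith
      apply abs_le_of_sq_le_sq _ two_pos.le
      nlinarith [sq_nonneg (acrossCoord ζ (x - y))]
    refine hle.trans ((h.measure_rectangle_le_of_le ζ y ha (le_min hab ha2)).trans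
      (ENNReal.ofReal_le_ofReal ?_))
    have e1 : min b 2 ≤ 2 * b ^ (1 - ε) := by
      calc min b 2 = min b 2 ^ ε * min b 2 ^ (1 - ε) := by
            rw [← Real.rpow_add hm]; simp
        _ ≤ 2 ^ ε * b ^ (1 - ε) := by
            have h1ε : 0 ≤ 1 - ε := by linarith
            gcongr
            · exact min_le_right _ _
            · exact min_le_left _ _
        _ ≤ 2 ^ (1 : ℝ) * b ^ (1 - ε) := by
            gcongr
            norm_num
        _ = _ := by norm_num
    calc 12 * C * a ^ (α - 1) * min b 2 ≤ 12 * C * a ^ (α - 1) * (2 * b ^ (1 - ε)) := by gcongr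
      _ = _ := by ring
  · refine (measure_mono (Set.subset_univ _)).trans (h.mass.trans (ENNReal.ofReal_le_ofReal ?_))
    have e1 : 1 ≤ a ^ (α - 1) := Real.one_le_rpow (by linarith) (by linarith)
    have e2 : 1 ≤ b ^ (1 - ε) := Real.one_le_rpow (by linarith) (by linarith)
    have e3 : 1 ≤ a ^ (α - 1) * b ^ (1 - ε) := one_le_mul_of_one_le_of_one_le e1 e2
    nlinarith

/-! ### Gaussian averages of the measure. -/

theorem exp_neg_sq_add_sq_le (p q : ℝ) :
    ∃ n : ℕ, |p| ≤ n + 1 ∧ |q| ≤ n + 1 ∧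
      Real.exp (-(Real.pi * (p ^ 2 + q ^ 2))) ≤ Real.exp (-n) := by
  refine ⟨⌊max |p| |q|⌋₊, ?_, ?_, ?_⟩
  · exact (le_max_left _ _).trans (Nat.lt_floor_add_one _).le
  · exact (le_max_right _ _).trans (Nat.lt_floor_add_one _).le
  · set n := ⌊max |p| |q|⌋₊ with hn
    have h1 : (n : ℝ) ≤ max |p| |q| := Nat.floor_le (le_max_of_le_left (abs_nonneg _))
    have h2 : (max |p| |q|) ^ 2 ≤ p ^ 2 + q ^ 2 := by
      rcases max_cases |p| |q| with ⟨e, _⟩ | ⟨e, _⟩ <;> rw [e, sq_abs] <;>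
        nlinarith [sq_nonneg p, sq_nonneg q]
    have h3 : (n : ℝ) ≤ (n : ℝ) ^ 2 := by
      exact_mod_cast Nat.le_self_pow two_ne_zero n
    have h4 : (n : ℝ) ^ 2 ≤ (max |p| |q|) ^ 2 := by gcongr
    apply Real.exp_le_exp.2
    have := Real.pi_gt_three
    nlinarith [sq_nonneg p, sq_nonneg q]

/-- The value at `w` of the Gaussian with widths `1 / B` and `1 / A` along and across `ζ`. -/
def gaussianWeight (ζ B A : ℝ) (w : Plane) : ℝ :=
  Real.exp (-(Real.pi * ((B * alongCoord ζ w) ^ 2 + (A * acrossCoord ζ w) ^ 2)))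

/-- The Gaussian is dominated by a sum of indicators of the dual rectangles dilated by `n + 1` with
weights `exp (-n)`; rectangle masses grow only polynomially in `n`. -/
theorem SquareFrostman.exists_lintegral_gaussianWeight_le {α C : ℝ} {ε : ℝ} (hε : 0 ≤ ε)
    (hε1 : ε ≤ 1) : ∃ K, 0 ≤ K ∧ ∀ (μ : Measure Plane), SquareFrostman μ α C →
    ∀ (ζ : ℝ) (y : Plane), y ∈ unitSquare → ∀ A B : ℝ, 0 < B → B ≤ A →
      ∫⁻ x, ENNReal.ofReal (gaussianWeight ζ B A (x - y)) ∂μ ≤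
        ENNReal.ofReal (K * A ^ (1 - α) * B ^ (ε - 1)) := by
  have hsum : Summable fun n : ℕ => Real.exp (-n) * ((n : ℝ) + 1) ^ 2 := by
    have h := (Real.summable_pow_mul_exp_neg_nat_mul 2 one_pos).comp_injective
      (add_left_injective 1) |>.mul_left (Real.exp 1)
    refine h.congr fun n => ?_
    simp only [Function.comp_apply]
    push_cast
    rw [mul_left_comm, ← Real.exp_add]
    ring_nf
  set S := ∑' n : ℕ, Real.exp (-n) * ((n : ℝ) + 1) ^ 2 with hS
  have hS0 : 0 ≤ S := tsum_nonneg fun n => by positivity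
  -- `K` is chosen before `μ`; for negative `C` there is no such `μ`.
  by_cases hC : 0 ≤ C
  swap
  · exact ⟨0, le_rfl, fun μ h => absurd h.nonneg hC⟩
  refine ⟨24 * C * S, by positivity, fun μ h ζ y hy A B hB hBA => ?_⟩
  have hA : 0 < A := hB.trans_le hBA
  have hα := h.one_lt
  have hα2 := h.le_two
  have hpt : ∀ x, ENNReal.ofReal (gaussianWeight ζ B A (x - y)) ≤
      ∑' n : ℕ, (rectangle ζ y ((n + 1) / B) ((n + 1) / A)).indicator
        (fun _ => ENNReal.ofReal (Real.exp (-n))) x := by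
    intro x
    obtain ⟨n, h1, h2, h3⟩ := exp_neg_sq_add_sq_le (B * alongCoord ζ (x - y))
      (A * acrossCoord ζ (x - y))
    refine le_trans ?_ (ENNReal.le_tsum n)
    rw [Set.indicator_of_mem]
    · exact ENNReal.ofReal_le_ofReal h3
    · rw [abs_mul, abs_of_pos hB] at h1
      rw [abs_mul, abs_of_pos hA] at h2
      exact ⟨(le_div_iff₀' hB).2 h1, (le_div_iff₀' hA).2 h2⟩
  calc ∫⁻ x, ENNReal.ofReal (gaussianWeight ζ B A (x - y)) ∂μ
      ≤ ∫⁻ x, ∑' n : ℕ, (rectangle ζ y ((n + 1) / B) ((n + 1) / A)).indicator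
        (fun _ => ENNReal.ofReal (Real.exp (-n))) x ∂μ := lintegral_mono hpt
    _ = ∑' n : ℕ, ENNReal.ofReal (Real.exp (-n)) *
          μ (rectangle ζ y ((n + 1) / B) ((n + 1) / A)) := by
        rw [lintegral_tsum fun n =>
          (measurable_const.indicator (measurableSet_rectangle _ _ _ _)).aemeasurable]
        congr 1; ext n
        rw [lintegral_indicator (measurableSet_rectangle _ _ _ _), setLIntegral_const]
    _ ≤ ∑' n : ℕ, ENNReal.ofReal
          (24 * C * A ^ (1 - α) * B ^ (ε - 1) * (Real.exp (-n) * ((n : ℝ) + 1) ^ 2)) := by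
        refine ENNReal.tsum_le_tsum fun n => ?_
        have hn : (1 : ℝ) ≤ n + 1 := by linarith [(Nat.cast_nonneg n : (0 : ℝ) ≤ n)]
        have hn0 : (0 : ℝ) < n + 1 := by linarith
        grw [h.measure_rectangle_le ζ hy (a := (n + 1) / A) (b := (n + 1) / B) (by positivity)
          (by gcongr) hε hε1]
        rw [← ENNReal.ofReal_mul (by positivity)]
        apply ENNReal.ofReal_le_ofReal
        rw [Real.div_rpow hn0.le hA.le, Real.div_rpow hn0.le hB.le]
        have e1 : (A ^ (α - 1))⁻¹ = A ^ (1 - α) := by rw [← Real.rpow_neg hA.le]; ring_nf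
        have e2 : (B ^ (1 - ε))⁻¹ = B ^ (ε - 1) := by rw [← Real.rpow_neg hB.le]; ring_nf
        have e3 : ((n : ℝ) + 1) ^ (α - 1) * ((n : ℝ) + 1) ^ (1 - ε) ≤ ((n : ℝ) + 1) ^ 2 := by
          rw [← Real.rpow_add hn0, ← Real.rpow_natCast]
          apply Real.rpow_le_rpow_of_exponent_le hn
          push_cast; linarith
        rw [div_eq_mul_inv, div_eq_mul_inv, e1, e2]
        calc _ = 24 * C * A ^ (1 - α) * B ^ (ε - 1) * (Real.exp (-n) *
              (((n : ℝ) + 1) ^ (α - 1) * ((n : ℝ) + 1) ^ (1 - ε))) := by ring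
          _ ≤ _ := by gcongr
    _ = ENNReal.ofReal (24 * C * A ^ (1 - α) * B ^ (ε - 1) * S) := by
        rw [hS, ← tsum_mul_left, ENNReal.ofReal_tsum_of_nonneg (fun n => by positivity)
          (hsum.mul_left _)]
    _ = _ := by ring_nf

/-! ### Mean square of the Fourier transform over rectangles. -/

/-- The squared modulus of the Fourier transform of `μ`. -/
def power (μ : Measure Plane) (ξ : Plane) : ℝ≥0∞ := ‖fourierMeasure μ ξ‖ₑ ^ 2

/-- The point with coordinates `x` in the orthonormal frame rotated by `ζ`. -/
def framePoint (ζ : ℝ) (x : ℝ × ℝ) : Plane :=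
  !₂[x.1 * Real.cos ζ - x.2 * Real.sin ζ, x.1 * Real.sin ζ + x.2 * Real.cos ζ]

@[fun_prop]
theorem continuous_framePoint (ζ : ℝ) : Continuous (framePoint ζ) := by
  unfold framePoint
  refine (PiLp.continuous_toLp 2 _).comp (continuous_pi fun i => ?_)
  fin_cases i <;> simp <;> fun_prop

theorem inner_framePoint (ζ : ℝ) (w : Plane) (x : ℝ × ℝ) :
    inner ℝ w (framePoint ζ x) = x.1 * alongCoord ζ w + x.2 * acrossCoord ζ w := by
  simp [PiLp.inner_apply, Fin.sum_univ_two, framePoint, alongCoord, acrossCoord]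
  ring

theorem norm_exp_ofReal_neg_mul_I (s : ℝ) : ‖Complex.exp (-(s : ℝ) * Complex.I)‖ = 1 := by
  have := Complex.norm_exp_ofReal_mul_I (-s)
  simpa using this

theorem continuous_fourierMeasure (μ : Measure Plane) [IsFiniteMeasure μ] :
    Continuous (fourierMeasure μ) := by
  unfold fourierMeasure
  refine continuous_of_dominated (bound := fun _ => 1) (fun ξ => ?_) (fun ξ => ?_)
    (integrable_const _) ?_
  · exact Continuous.aestronglyMeasurable (by fun_prop)
  · exact Filter.Eventually.of_forall fun x => by
      simpa using (norm_exp_ofReal_neg_mul_I (2 * Real.pi * inner ℝ x ξ)).le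
  · exact Filter.Eventually.of_forall fun x => by fun_prop

@[fun_prop]
theorem measurable_power (μ : Measure Plane) [IsFiniteMeasure μ] : Measurable (power μ) := by
  unfold power
  have := (continuous_fourierMeasure μ).measurable
  fun_prop

theorem power_le (μ : Measure Plane) (ξ : Plane) : power μ ξ ≤ μ Set.univ ^ 2 := by
  unfold power
  gcongr
  refine (enorm_integral_le_lintegral_enorm _).trans ?_
  have : ∀ x : Plane, ‖Complex.exp (-(2 * Real.pi * inner ℝ x ξ : ℝ) * Complex.I)‖ₑ = 1 := by
    intro x
    rw [← ofReal_norm, norm_exp_ofReal_neg_mul_I]; simp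
  simp only [this]
  simp

theorem fourierMeasure_neg (μ : Measure Plane) (ξ : Plane) :
    fourierMeasure μ (-ξ) = starRingEnd ℂ (fourierMeasure μ ξ) := by
  unfold fourierMeasure
  rw [← integral_conj]
  congr 1; ext x
  rw [← Complex.exp_conj]
  simp [Complex.conj_ofNat]

theorem power_neg (μ : Measure Plane) (ξ : Plane) : power μ (-ξ) = power μ ξ := by
  rw [power, power, fourierMeasure_neg]
  congr 1
  rw [← ofReal_norm, ← ofReal_norm, Complex.norm_conj]

theorem norm_integral_exp_mul_gaussian {B : ℝ} (hB : 0 < B) (s : ℝ) :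
    ‖∫ x : ℝ, Complex.exp (-(2 * Real.pi * (x * s) : ℝ) * Complex.I) *
      (Real.exp (-(Real.pi * (x / B) ^ 2)) : ℂ)‖ = B * Real.exp (-(Real.pi * (B * s) ^ 2)) := by
  have hpi := Real.pi_pos
  have hb : 0 < ((Real.pi / B ^ 2 : ℝ) : ℂ).re := by
    rw [Complex.ofReal_re]; positivity
  have h := fourierIntegral_gaussian hb ((-(2 * Real.pi * s) : ℝ) : ℂ)
  have e : ∀ x : ℝ, Complex.exp (-(2 * Real.pi * (x * s) : ℝ) * Complex.I) *
      (Real.exp (-(Real.pi * (x / B) ^ 2)) : ℂ) =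
      Complex.exp (Complex.I * ((-(2 * Real.pi * s) : ℝ) : ℂ) * x) *
        Complex.exp (-((Real.pi / B ^ 2 : ℝ) : ℂ) * (x : ℂ) ^ 2) := by
    intro x
    rw [Complex.ofReal_exp]
    congr 2
    · push_cast; ring
    · push_cast; ring
  simp_rw [e]
  rw [h, norm_mul]
  congr 1
  · have : (Real.pi : ℂ) / ((Real.pi / B ^ 2 : ℝ) : ℂ) = ((B ^ 2 : ℝ) : ℂ) := by
      rw [← Complex.ofReal_div]
      congr 1
      field_simp
    rw [this, Complex.norm_cpow_eq_rpow_re_of_pos (by positivity)]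
    have : ((1 : ℂ) / 2).re = 1 / 2 := by norm_num
    rw [this, ← Real.sqrt_eq_rpow, Real.sqrt_sq hB.le]
  · have : -((-(2 * Real.pi * s) : ℝ) : ℂ) ^ 2 / (4 * ((Real.pi / B ^ 2 : ℝ) : ℂ)) =
        ((-(Real.pi * (B * s) ^ 2) : ℝ) : ℂ) := by
      rw [← Complex.ofReal_pow, ← Complex.ofReal_neg, ← Complex.ofReal_ofNat,
        ← Complex.ofReal_mul, ← Complex.ofReal_div]
      congr 1
      field_simp
      ring
    rw [this, Complex.norm_exp_ofReal]

theorem fourierMeasure_mul_conj (μ : Measure Plane) [IsFiniteMeasure μ] (ξ : Plane) :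
    fourierMeasure μ ξ * starRingEnd ℂ (fourierMeasure μ ξ) =
      ∫ p : Plane × Plane, Complex.exp (-(2 * Real.pi * inner ℝ (p.1 - p.2) ξ : ℝ) * Complex.I)
        ∂μ.prod μ := by
  rw [← fourierMeasure_neg, fourierMeasure, fourierMeasure, ← integral_prod_mul]
  congr 1; ext p
  rw [← Complex.exp_add]
  congr 1
  rw [inner_sub_left, inner_neg_right]
  push_cast
  ring

/-- The Gaussian with widths `B` and `A` along the coordinate axes. -/
def planeGaussian (B A : ℝ) (x : ℝ × ℝ) : ℝ :=
  Real.exp (-(Real.pi * (x.1 / B) ^ 2)) * Real.exp (-(Real.pi * (x.2 / A) ^ 2))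

theorem integrable_planeGaussian {B A : ℝ} (hB : 0 < B) (hA : 0 < A) :
    Integrable (planeGaussian B A) := by
  have h : ∀ {B : ℝ}, 0 < B → Integrable fun x : ℝ => Real.exp (-(Real.pi * (x / B) ^ 2)) := by
    intro B hB
    have := integrable_exp_neg_mul_sq (b := Real.pi / B ^ 2) (by have := Real.pi_pos; positivity)
    refine this.congr (Filter.Eventually.of_forall fun x => ?_)
    simp only
    congr 1
    ring
  exact (h hB).mul_prod (h hA)

theorem enorm_integral_exp_mul_planeGaussian {B A : ℝ} (hB : 0 < B) (hA : 0 < A) (ζ : ℝ)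
    (η w : Plane) :
    ‖∫ x : ℝ × ℝ, (planeGaussian B A x : ℂ) *
      Complex.exp (-(2 * Real.pi * inner ℝ w (η + framePoint ζ x) : ℝ) * Complex.I)‖ₑ =
      ENNReal.ofReal (B * A * gaussianWeight ζ B A w) := by
  have e : ∀ x : ℝ × ℝ, (planeGaussian B A x : ℂ) *
      Complex.exp (-(2 * Real.pi * inner ℝ w (η + framePoint ζ x) : ℝ) * Complex.I) =
      Complex.exp (-(2 * Real.pi * inner ℝ w η : ℝ) * Complex.I) *
      ((Complex.exp (-(2 * Real.pi * (x.1 * alongCoord ζ w) : ℝ) * Complex.I) *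
        (Real.exp (-(Real.pi * (x.1 / B) ^ 2)) : ℂ)) *
      (Complex.exp (-(2 * Real.pi * (x.2 * acrossCoord ζ w) : ℝ) * Complex.I) *
        (Real.exp (-(Real.pi * (x.2 / A) ^ 2)) : ℂ))) := by
    intro x
    have : Complex.exp (-(2 * Real.pi * inner ℝ w (η + framePoint ζ x) : ℝ) * Complex.I) =
        Complex.exp (-(2 * Real.pi * inner ℝ w η : ℝ) * Complex.I) *
        Complex.exp (-(2 * Real.pi * (x.1 * alongCoord ζ w) : ℝ) * Complex.I) *
        Complex.exp (-(2 * Real.pi * (x.2 * acrossCoord ζ w) : ℝ) * Complex.I) := by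
      rw [← Complex.exp_add, ← Complex.exp_add, inner_add_right, inner_framePoint]
      congr 1
      push_cast
      ring
    rw [this, planeGaussian]
    push_cast
    ring
  simp_rw [e]
  rw [integral_const_mul, Measure.volume_eq_prod, integral_prod_mul
    (fun x : ℝ => Complex.exp (-(2 * Real.pi * (x * alongCoord ζ w) : ℝ) * Complex.I) *
      (Real.exp (-(Real.pi * (x / B) ^ 2)) : ℂ))
    (fun x : ℝ => Complex.exp (-(2 * Real.pi * (x * acrossCoord ζ w) : ℝ) * Complex.I) *
      (Real.exp (-(Real.pi * (x / A) ^ 2)) : ℂ)), ← ofReal_norm, norm_mul, norm_mul,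
    norm_exp_ofReal_neg_mul_I, norm_integral_exp_mul_gaussian hB,
    norm_integral_exp_mul_gaussian hA, gaussianWeight, mul_add, neg_add, Real.exp_add]
  congr 1
  ring

/-- Writing `|μ̂|²` as a double integral of characters against `μ × μ` and exchanging the integrals
puts the Fourier transform on the Gaussian. The centre `η` contributes only a phase, which
disappears in the modulus. -/
theorem lintegral_planeGaussian_mul_power_le (μ : Measure Plane) [IsFiniteMeasure μ] {B A : ℝ}
    (hB : 0 < B) (hA : 0 < A) (ζ : ℝ) (η : Plane) :
    ∫⁻ x : ℝ × ℝ, ENNReal.ofReal (planeGaussian B A x) * power μ (η + framePoint ζ x) ≤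
      ∫⁻ p : Plane × Plane, ENNReal.ofReal (B * A * gaussianWeight ζ B A (p.1 - p.2))
        ∂μ.prod μ := by
  have hG := integrable_planeGaussian hB hA
  have hG0 : ∀ x, 0 ≤ planeGaussian B A x := fun x => by unfold planeGaussian; positivity
  have hGc : Continuous (planeGaussian B A) := by unfold planeGaussian; fun_prop
  have hc := continuous_fourierMeasure μ
  have e1 : ∀ x : ℝ × ℝ, ENNReal.ofReal (planeGaussian B A x) * power μ (η + framePoint ζ x) =
      ENNReal.ofReal (planeGaussian B A x * ‖fourierMeasure μ (η + framePoint ζ x)‖ ^ 2) := by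
    intro x
    rw [ENNReal.ofReal_mul (hG0 x), power, ENNReal.ofReal_pow (norm_nonneg _),
      ofReal_norm]
  have hint : Integrable (Function.uncurry fun (x : ℝ × ℝ) (p : Plane × Plane) =>
      (planeGaussian B A x : ℂ) * Complex.exp
        (-(2 * Real.pi * inner ℝ (p.1 - p.2) (η + framePoint ζ x) : ℝ) * Complex.I))
      ((volume : Measure (ℝ × ℝ)).prod (μ.prod μ)) := by
    have h1 : Integrable (fun z : (ℝ × ℝ) × (Plane × Plane) => planeGaussian B A z.1 * (1 : ℝ))
        ((volume : Measure (ℝ × ℝ)).prod (μ.prod μ)) :=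
      hG.mul_prod (integrable_const (1 : ℝ))
    refine h1.mono' ?_ ?_
    · refine Continuous.aestronglyMeasurable ?_
      unfold Function.uncurry
      fun_prop
    · refine Filter.Eventually.of_forall fun z => ?_
      simp only [Function.uncurry]
      rw [norm_mul, norm_exp_ofReal_neg_mul_I, Complex.norm_real, Real.norm_of_nonneg (hG0 _)]
  have e2 : ∀ x : ℝ × ℝ, ((planeGaussian B A x * ‖fourierMeasure μ (η + framePoint ζ x)‖ ^ 2 : ℝ)
      : ℂ) = ∫ p : Plane × Plane, (planeGaussian B A x : ℂ) * Complex.exp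
        (-(2 * Real.pi * inner ℝ (p.1 - p.2) (η + framePoint ζ x) : ℝ) * Complex.I)
        ∂μ.prod μ := by
    intro x
    rw [integral_const_mul, ← fourierMeasure_mul_conj, Complex.mul_conj, Complex.normSq_eq_norm_sq]
    push_cast
    ring
  have hint2 : Integrable fun x : ℝ × ℝ =>
      ((planeGaussian B A x * ‖fourierMeasure μ (η + framePoint ζ x)‖ ^ 2 : ℝ) : ℂ) := by
    simp_rw [e2]
    exact hint.integral_prod_left
  have hint3 : Integrable fun x : ℝ × ℝ =>
      planeGaussian B A x * ‖fourierMeasure μ (η + framePoint ζ x)‖ ^ 2 := by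
    simpa only [RCLike.re_to_complex, Complex.ofReal_re] using hint2.re
  simp_rw [e1]
  rw [← ofReal_integral_eq_lintegral_ofReal hint3
    (Filter.Eventually.of_forall fun x => mul_nonneg (hG0 x) (by positivity))]
  calc ENNReal.ofReal (∫ x : ℝ × ℝ,
        planeGaussian B A x * ‖fourierMeasure μ (η + framePoint ζ x)‖ ^ 2)
      ≤ ‖((∫ x : ℝ × ℝ, planeGaussian B A x * ‖fourierMeasure μ (η + framePoint ζ x)‖ ^ 2 : ℝ)
          : ℂ)‖ₑ := by
        rw [← ofReal_norm, Complex.norm_real]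
        exact ENNReal.ofReal_le_ofReal (le_abs_self _)
    _ = ‖∫ p : Plane × Plane, (∫ x : ℝ × ℝ, (planeGaussian B A x : ℂ) * Complex.exp
        (-(2 * Real.pi * inner ℝ (p.1 - p.2) (η + framePoint ζ x) : ℝ) * Complex.I))
        ∂μ.prod μ‖ₑ := by
        rw [← integral_complex_ofReal]
        simp_rw [e2]
        rw [integral_integral_swap hint]
    _ ≤ _ := by
        refine (enorm_integral_le_lintegral_enorm _).trans (le_of_eq ?_)
        simp_rw [enorm_integral_exp_mul_planeGaussian hB hA]

/-- The mean square of the Fourier transform over a rectangle with half sides `B ≤ A` is controlled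
by the mass of dual rectangles. -/
theorem exists_setLIntegral_power_le (α C : ℝ) {ε : ℝ} (hε : 0 ≤ ε) (hε1 : ε ≤ 1) :
    ∃ K, 0 ≤ K ∧ ∀ (μ : Measure Plane), SquareFrostman μ α C →
      ∀ (ζ : ℝ) (η : Plane) (A B : ℝ), 0 < B → B ≤ A →
        ∫⁻ x in Set.Icc (-B) B ×ˢ Set.Icc (-A) A, power μ (η + framePoint ζ x) ≤
          ENNReal.ofReal (K * A ^ (2 - α) * B ^ ε) := by
  obtain ⟨K, hK, h⟩ := SquareFrostman.exists_lintegral_gaussianWeight_le (α := α) (C := C) hε hε1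
  by_cases hC : 0 ≤ C
  swap
  · exact ⟨0, le_rfl, fun μ h => absurd h.nonneg hC⟩
  -- On the rectangle `planeGaussian` is at least `exp (-2π)`; the factor `C` is the mass in the
  -- outer integral.
  refine ⟨Real.exp (2 * Real.pi) * (K * C), by positivity, fun μ hμ ζ η A B hB hBA => ?_⟩
  have hA : 0 < A := hB.trans_le hBA
  have := hμ.isFiniteMeasure
  have hpt : ∀ x ∈ Set.Icc (-B) B ×ˢ Set.Icc (-A) A, power μ (η + framePoint ζ x) ≤
      ENNReal.ofReal (Real.exp (2 * Real.pi)) *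
        (ENNReal.ofReal (planeGaussian B A x) * power μ (η + framePoint ζ x)) := by
    rintro x ⟨hx1, hx2⟩
    rw [← mul_assoc, ← ENNReal.ofReal_mul (by positivity)]
    apply le_mul_of_one_le_left'
    rw [← ENNReal.ofReal_one]
    apply ENNReal.ofReal_le_ofReal
    rw [planeGaussian, ← Real.exp_add, ← Real.exp_add]
    apply Real.one_le_exp
    have h1 : (x.1 / B) ^ 2 ≤ 1 := by
      rw [sq_le_one_iff_abs_le_one, abs_div, abs_of_pos hB, div_le_one hB]
      exact abs_le.2 hx1
    have h2 : (x.2 / A) ^ 2 ≤ 1 := by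
      rw [sq_le_one_iff_abs_le_one, abs_div, abs_of_pos hA, div_le_one hA]
      exact abs_le.2 hx2
    have := Real.pi_pos
    nlinarith
  calc ∫⁻ x in Set.Icc (-B) B ×ˢ Set.Icc (-A) A, power μ (η + framePoint ζ x)
      ≤ ∫⁻ x in Set.Icc (-B) B ×ˢ Set.Icc (-A) A, ENNReal.ofReal (Real.exp (2 * Real.pi)) *
        (ENNReal.ofReal (planeGaussian B A x) * power μ (η + framePoint ζ x)) :=
        setLIntegral_mono' (measurableSet_Icc.prod measurableSet_Icc) hpt
    _ ≤ ENNReal.ofReal (Real.exp (2 * Real.pi)) *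
        ∫⁻ x, ENNReal.ofReal (planeGaussian B A x) * power μ (η + framePoint ζ x) := by
        rw [lintegral_const_mul' _ _ ENNReal.ofReal_ne_top]
        exact mul_le_mul_right (setLIntegral_le_lintegral _ _) _
    _ ≤ ENNReal.ofReal (Real.exp (2 * Real.pi)) * ∫⁻ p : Plane × Plane,
          ENNReal.ofReal (B * A * gaussianWeight ζ B A (p.1 - p.2)) ∂μ.prod μ := by
        gcongr
        exact lintegral_planeGaussian_mul_power_le μ hB hA ζ η
    _ = ENNReal.ofReal (Real.exp (2 * Real.pi)) * (ENNReal.ofReal (B * A) * ∫⁻ v, ∫⁻ u,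
          ENNReal.ofReal (gaussianWeight ζ B A (u - v)) ∂μ ∂μ) := by
        congr 1
        simp_rw [ENNReal.ofReal_mul (mul_nonneg hB.le hA.le)]
        rw [lintegral_const_mul' _ _ ENNReal.ofReal_ne_top, lintegral_prod_symm]
        refine Measurable.aemeasurable ?_
        unfold gaussianWeight
        have h1 := (continuous_alongCoord ζ).measurable
        have h2 := (continuous_acrossCoord ζ).measurable
        fun_prop
    _ ≤ ENNReal.ofReal (Real.exp (2 * Real.pi)) * (ENNReal.ofReal (B * A) * ∫⁻ v,
          ENNReal.ofReal (K * A ^ (1 - α) * B ^ (ε - 1)) ∂μ) := by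
        refine mul_le_mul_right (mul_le_mul_right (lintegral_mono_ae ?_) _) _
        filter_upwards [hμ.carried] with v hv
        exact h μ hμ ζ v hv A B hB hBA
    _ ≤ ENNReal.ofReal (Real.exp (2 * Real.pi)) * (ENNReal.ofReal (B * A) *
          (ENNReal.ofReal (K * A ^ (1 - α) * B ^ (ε - 1)) * ENNReal.ofReal C)) := by
        rw [lintegral_const]
        gcongr
        exact hμ.mass
    _ = _ := by
        rw [← ENNReal.ofReal_mul (by positivity), ← ENNReal.ofReal_mul (by positivity),
          ← ENNReal.ofReal_mul (by positivity)]
        congr 1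
        have e1 : A ^ (2 - α) = A ^ (1 - α) * A := by
          rw [← Real.rpow_add_one hA.ne']; ring_nf
        have e2 : B ^ ε = B ^ (ε - 1) * B := by
          rw [← Real.rpow_add_one hB.ne']; ring_nf
        rw [e1, e2]
        ring

/-! ### Dilations, periodic functions and polar coordinates. -/

theorem lintegral_comp_mul_left {g : ℝ → ℝ≥0∞} (hg : Measurable g) {a : ℝ} (ha : 0 < a) :
    ∫⁻ x, g (a * x) = ENNReal.ofReal a⁻¹ * ∫⁻ x, g x := by
  rw [← lintegral_map hg (measurable_const_mul a), Real.map_volume_mul_left ha.ne',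
    lintegral_smul_measure, abs_of_pos (inv_pos.2 ha), smul_eq_mul]

theorem setLIntegral_Ioi_comp_mul_left {g : ℝ → ℝ≥0∞} (hg : Measurable g) {a : ℝ} (ha : 0 < a)
    (c : ℝ) : ∫⁻ x in Set.Ioi c, g (a * x) =
      ENNReal.ofReal a⁻¹ * ∫⁻ x in Set.Ioi (a * c), g x := by
  rw [← lintegral_indicator measurableSet_Ioi, ← lintegral_indicator measurableSet_Ioi,
    ← lintegral_comp_mul_left (hg.indicator measurableSet_Ioi) ha]
  congr 1; ext x
  simp only [Set.indicator, Set.mem_Ioi, mul_lt_mul_iff_right₀ ha]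

theorem periodic_setLIntegral_Ioc_eq {g : ℝ → ℝ≥0∞} {c : ℝ} (hg : Function.Periodic g c)
    (hc : 0 < c) (a b : ℝ) : ∫⁻ x in Set.Ioc a (a + c), g x = ∫⁻ x in Set.Ioc b (b + c), g x := by
  refine (isAddFundamentalDomain_Ioc hc a volume).setLIntegral_eq
    (isAddFundamentalDomain_Ioc hc b volume) g ?_
  rintro ⟨_, n, rfl⟩ x
  have : (n • c +ᵥ x : ℝ) = x + n • c := by rw [vadd_eq_add, add_comm]
  change g (n • c +ᵥ x) = g x
  rw [this]
  exact hg.zsmul n x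

theorem periodic_setLIntegral_Ioc_add {g : ℝ → ℝ≥0∞} {c : ℝ} (hg : Function.Periodic g c)
    (hc : 0 < c) (s : ℝ) :
    ∫⁻ x in Set.Ioc 0 c, g (x + s) = ∫⁻ x in Set.Ioc 0 c, g x := by
  have h1 : ∫⁻ x in Set.Ioc 0 c, g (x + s) = ∫⁻ x in Set.Ioc s (s + c), g x := by
    rw [← lintegral_indicator measurableSet_Ioc, ← lintegral_indicator measurableSet_Ioc,
      ← lintegral_add_right_eq_self ((Set.Ioc s (s + c)).indicator g) s]
    congr 1; ext x
    simp [Set.indicator, add_comm s c]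
  rw [h1, periodic_setLIntegral_Ioc_eq hg hc s 0, zero_add]

theorem periodic_setLIntegral_Ioc_two_mul {g : ℝ → ℝ≥0∞} {c : ℝ} (hg : Function.Periodic g c)
    (hc : 0 < c) :
    ∫⁻ x in Set.Ioc 0 (2 * c), g x = 2 * ∫⁻ x in Set.Ioc (-(c / 2)) (c / 2), g x := by
  have h1 : Set.Ioc 0 (2 * c) = Set.Ioc 0 (0 + c) ∪ Set.Ioc c (c + c) := by
    rw [zero_add, Set.Ioc_union_Ioc_eq_Ioc hc.le (by linarith)]; ring_nf
  have h2 : Set.Ioc (-(c / 2)) (c / 2) = Set.Ioc (-(c / 2)) (-(c / 2) + c) := by ring_nf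
  rw [h1, lintegral_union measurableSet_Ioc, periodic_setLIntegral_Ioc_eq hg hc 0 (-(c / 2)),
    periodic_setLIntegral_Ioc_eq hg hc c (-(c / 2)), ← h2, two_mul]
  rw [zero_add]
  exact Set.Ioc_disjoint_Ioc_of_le le_rfl

theorem setLIntegral_Ioi_rpow {p r : ℝ} (hp : p < -1) (hr : 0 < r) :
    ∫⁻ x in Set.Ioi r, ENNReal.ofReal (x ^ p) = ENNReal.ofReal (r ^ (p + 1) / (-p - 1)) := by
  rw [← ofReal_integral_eq_lintegral_ofReal (integrableOn_Ioi_rpow_of_lt hp hr),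
    integral_Ioi_rpow_of_lt hp hr]
  · congr 1
    rw [← neg_div_neg_eq]; ring_nf
  · filter_upwards [ae_restrict_mem measurableSet_Ioi] with x hx
    exact Real.rpow_nonneg (hr.le.trans (le_of_lt hx)) _

theorem lintegral_eq_two_mul_of_even {g : ℝ → ℝ≥0∞} (hg : ∀ x, g (-x) = g x) :
    ∫⁻ x, g x = 2 * ∫⁻ x in Set.Ioi 0, g x := by
  have h1 : ∫⁻ x in Set.Iic 0, g x = ∫⁻ x in Set.Ioi 0, g x := by
    rw [setLIntegral_congr (Iio_ae_eq_Iic (a := (0 : ℝ))).symm,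
      ← lintegral_indicator measurableSet_Iio, ← lintegral_indicator measurableSet_Ioi,
      ← lintegral_neg_eq_self]
    congr 1; ext x
    simp [Set.indicator, hg]
  have h2 := lintegral_add_compl g (measurableSet_Iic (a := (0 : ℝ))) (μ := volume)
  rw [Set.compl_Iic, h1] at h2
  rw [← h2, two_mul]

theorem lintegral_polar {g : ℝ × ℝ → ℝ≥0∞} (hg : Measurable g) :
    ∫⁻ x, g x = ∫⁻ r in Set.Ioi 0, ∫⁻ τ in Set.Ioo (-Real.pi) Real.pi,
      ENNReal.ofReal r * g (r * Real.cos τ, r * Real.sin τ) := by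
  rw [← lintegral_comp_polarCoord_symm, polarCoord_target, Measure.volume_eq_prod,
    setLIntegral_prod]
  · simp [polarCoord_symm_apply]
  · simp only [polarCoord_symm_apply, smul_eq_mul]
    exact Measurable.aemeasurable (by fun_prop)

/-! ### Thin sectors and radial segments. -/

@[fun_prop]
theorem continuous_circlePoint : Continuous circlePoint := by
  unfold circlePoint
  refine (PiLp.continuous_toLp 2 _).comp (continuous_pi fun i => ?_)
  fin_cases i <;> simp <;> fun_prop

theorem framePoint_polar (ζ r τ : ℝ) :
    framePoint ζ (r * Real.cos τ, r * Real.sin τ) = r • circlePoint (ζ + τ) := by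
  ext i
  fin_cases i <;> simp [framePoint, circlePoint, Real.cos_add, Real.sin_add] <;> ring

theorem framePoint_add (ζ : ℝ) (x y : ℝ × ℝ) :
    framePoint ζ (x + y) = framePoint ζ x + framePoint ζ y := by
  ext i
  fin_cases i <;> simp [framePoint] <;> ring

/-- The ratios of radii in `[1/8, 8]` at distance at most `w` from `1`. -/
def radialSlice (w : ℝ) : Set ℝ := {σ | (1 / 8 ≤ σ ∧ σ ≤ 8) ∧ |σ - 1| ≤ w}

theorem measurableSet_radialSlice (w : ℝ) : MeasurableSet (radialSlice w) := by
  have h1 : IsClosed {σ : ℝ | |σ - 1| ≤ w} := isClosed_le (by fun_prop) continuous_const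
  exact ((isClosed_Icc (a := (1 / 8 : ℝ)) (b := 8)).inter h1).measurableSet

/-- The mean square of the Fourier transform over a thin sector of an annulus. -/
theorem exists_lintegral_sector_le (α C : ℝ) {ε : ℝ} (hε : 0 ≤ ε) (hε1 : ε ≤ 1) :
    ∃ K, 0 ≤ K ∧ ∀ (μ : Measure Plane), SquareFrostman μ α C →
      ∀ (t ζ a w : ℝ), 0 < t → 0 < w → w ≤ a → a < Real.pi → a ^ 2 ≤ 4 * w →
        ∫⁻ τ in Set.Icc (-a) a, ∫⁻ σ in radialSlice (128 * w),
          power μ ((t * σ) • circlePoint (ζ + τ)) ≤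
          ENNReal.ofReal (K * (t ^ 2)⁻¹ * (t * a) ^ (2 - α) * (t * w) ^ ε) := by
  obtain ⟨K, hK, h⟩ := exists_setLIntegral_power_le α C hε hε1
  refine ⟨8 * (K * (144 ^ (2 - α) * 144 ^ ε)), by positivity,
    fun μ hμ t ζ a w ht hw hwa haπ haw => ?_⟩
  have := hμ.isFiniteMeasure
  have ha : 0 < a := hw.trans_le hwa
  set box : Set (ℝ × ℝ) := Set.Icc (-(144 * (t * w))) (144 * (t * w)) ×ˢ
    Set.Icc (-(144 * (t * a))) (144 * (t * a)) with hbox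
  have hboxm : MeasurableSet box := measurableSet_Icc.prod measurableSet_Icc
  set G : ℝ × ℝ → ℝ≥0∞ := fun x => box.indicator
    (fun y => power μ (framePoint ζ (t, 0) + framePoint ζ y)) (x - (t, 0)) with hG
  have hGm : Measurable G := by
    have h1 : Measurable fun y => power μ (framePoint ζ (t, 0) + framePoint ζ y) :=
      (measurable_power μ).comp (by fun_prop)
    exact (h1.indicator hboxm).comp (by fun_prop)
  have hpt : ∀ τ ∈ Set.Icc (-a) a, ∀ σ ∈ radialSlice (128 * w),
      power μ ((t * σ) • circlePoint (ζ + τ)) ≤ ENNReal.ofReal (8 / t) *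
        (ENNReal.ofReal (t * σ) * G (t * σ * Real.cos τ, t * σ * Real.sin τ)) := by
    rintro τ hτ σ ⟨⟨h1, h2⟩, h3⟩
    -- Along the axis, `|σ - 1| ≤ 128 w` and the curvature loss `σ τ² / 2 ≤ 8 * 4 w / 2 = 16 w` add
    -- up to `144 w`; this is where `a² ≤ 4 w` enters. Across it, `8 a` would be enough.
    have hmem : ((t * σ * Real.cos τ, t * σ * Real.sin τ) - (t, 0) : ℝ × ℝ) ∈ box := by
      have hc := Real.one_sub_sq_div_two_le_cos (x := τ)
      have hc1 := Real.cos_le_one τ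
      have hτa : |τ| ≤ a := abs_le.2 hτ
      have hτ2 : τ ^ 2 ≤ a ^ 2 := by rw [← sq_abs]; gcongr
      rw [abs_le] at h3
      constructor
      · simp only [Prod.fst_sub]
        have e : t * σ * Real.cos τ - t = t * (σ * Real.cos τ - 1) := by ring
        have e2 : 144 * (t * w) = t * (144 * w) := by ring
        have e3 : -(t * (144 * w)) = t * (-(144 * w)) := by ring
        rw [e, e2, e3]
        constructor
        · gcongr
          nlinarith
        · gcongr
          nlinarith
      · simp only [Prod.snd_sub, sub_zero]
        have e : t * σ * Real.sin τ = t * (σ * Real.sin τ) := by ring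
        have e2 : 144 * (t * a) = t * (144 * a) := by ring
        have e3 : -(t * (144 * a)) = t * (-(144 * a)) := by ring
        have hb : |σ * Real.sin τ| ≤ 144 * a := by
          rw [abs_mul, abs_of_pos (by linarith)]
          have := Real.abs_sin_le_abs.trans hτa
          nlinarith [abs_nonneg (Real.sin τ)]
        rw [abs_le] at hb
        rw [e, e2, e3]
        exact ⟨mul_le_mul_of_nonneg_left hb.1 ht.le, mul_le_mul_of_nonneg_left hb.2 ht.le⟩
    simp only [hG]
    rw [Set.indicator_of_mem hmem, ← framePoint_add, add_sub_cancel, framePoint_polar,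
      ← mul_assoc, ← ENNReal.ofReal_mul (by positivity)]
    apply le_mul_of_one_le_left'
    rw [← ENNReal.ofReal_one]
    apply ENNReal.ofReal_le_ofReal
    field_simp
    linarith
  have hslice : radialSlice (128 * w) ⊆ Set.Ioi 0 := fun σ hσ => by
    have := hσ.1.1
    simp only [Set.mem_Ioi]; linarith
  calc ∫⁻ τ in Set.Icc (-a) a, ∫⁻ σ in radialSlice (128 * w),
          power μ ((t * σ) • circlePoint (ζ + τ))
      ≤ ∫⁻ τ in Set.Icc (-a) a, ∫⁻ σ in radialSlice (128 * w), ENNReal.ofReal (8 / t) *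
        (ENNReal.ofReal (t * σ) * G (t * σ * Real.cos τ, t * σ * Real.sin τ)) :=
        setLIntegral_mono' measurableSet_Icc fun τ hτ =>
          setLIntegral_mono' (measurableSet_radialSlice _) fun σ hσ => hpt τ hτ σ hσ
    _ ≤ ∫⁻ τ in Set.Ioo (-Real.pi) Real.pi, ∫⁻ σ in Set.Ioi 0, ENNReal.ofReal (8 / t) *
        (ENNReal.ofReal (t * σ) * G (t * σ * Real.cos τ, t * σ * Real.sin τ)) :=
        (lintegral_mono_set (Set.Icc_subset_Ioo (by linarith) haπ)).trans
          (lintegral_mono fun τ => lintegral_mono_set hslice)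
    _ = ∫⁻ τ in Set.Ioo (-Real.pi) Real.pi, ENNReal.ofReal (8 / t) * (ENNReal.ofReal t⁻¹ *
          ∫⁻ r in Set.Ioi 0, ENNReal.ofReal r * G (r * Real.cos τ, r * Real.sin τ)) := by
        congr 1; ext τ
        rw [lintegral_const_mul' _ _ ENNReal.ofReal_ne_top, setLIntegral_Ioi_comp_mul_left
          (g := fun r => ENNReal.ofReal r * G (r * Real.cos τ, r * Real.sin τ)) (by fun_prop) ht,
          mul_zero]
    _ = ENNReal.ofReal (8 / t) * (ENNReal.ofReal t⁻¹ * ∫⁻ x, G x) := by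
        rw [lintegral_const_mul' _ _ ENNReal.ofReal_ne_top,
          lintegral_const_mul' _ _ ENNReal.ofReal_ne_top, lintegral_polar hGm,
          lintegral_lintegral_swap]
        exact Measurable.aemeasurable (by unfold Function.uncurry; fun_prop)
    _ = ENNReal.ofReal (8 / t) * (ENNReal.ofReal t⁻¹ *
          ∫⁻ x in box, power μ (framePoint ζ (t, 0) + framePoint ζ x)) := by
        rw [← lintegral_indicator hboxm, ← lintegral_sub_right_eq_self (box.indicator _)
          ((t, 0) : ℝ × ℝ)]
    _ ≤ ENNReal.ofReal (8 / t) * (ENNReal.ofReal t⁻¹ *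
          ENNReal.ofReal (K * (144 * (t * a)) ^ (2 - α) * (144 * (t * w)) ^ ε)) := by
        gcongr
        exact h μ hμ ζ _ _ _ (by positivity) (by gcongr)
    _ = _ := by
        rw [← ENNReal.ofReal_mul (by positivity), ← ENNReal.ofReal_mul (by positivity),
          Real.mul_rpow (y := t * a) (by norm_num) (by positivity),
          Real.mul_rpow (y := t * w) (by norm_num) (by positivity)]
        congr 1
        generalize (t * a) ^ (2 - α) = u
        generalize (t * w) ^ ε = v
        field_simp

/-- The integral of the squared Fourier transform over a radial segment of relative half width `w`
at distance about `t` from the origin in the direction `τ`. -/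
def sliceEnergy (μ : Measure Plane) (t w τ : ℝ) : ℝ≥0∞ :=
  ∫⁻ σ in radialSlice w, power μ ((t * σ) • circlePoint τ)

theorem sliceEnergy_mono (μ : Measure Plane) (t τ : ℝ) {w w' : ℝ} (h : w ≤ w') :
    sliceEnergy μ t w τ ≤ sliceEnergy μ t w' τ :=
  lintegral_mono_set fun _ hσ => ⟨hσ.1, hσ.2.trans h⟩

theorem measurable_sliceEnergy (μ : Measure Plane) [IsFiniteMeasure μ] (t : ℝ) :
    Measurable fun p : ℝ × ℝ => sliceEnergy μ t p.1 p.2 := by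
  have e : (fun p : ℝ × ℝ => sliceEnergy μ t p.1 p.2) = fun p => ∫⁻ σ,
      {q : (ℝ × ℝ) × ℝ | q.2 ∈ radialSlice q.1.1}.indicator
        (fun q => power μ ((t * q.2) • circlePoint q.1.2)) (p, σ) := by
    ext p
    rw [sliceEnergy, ← lintegral_indicator (measurableSet_radialSlice _)]
    rfl
  rw [e]
  refine Measurable.lintegral_prod_right'
    (f := {q : (ℝ × ℝ) × ℝ | q.2 ∈ radialSlice q.1.1}.indicator (fun q => power μ ((t * q.2) • circlePoint q.1.2))) ?_
  refine Measurable.indicator ?_ ?_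
  · exact (measurable_power μ).comp (by fun_prop)
  · have h1 : IsClosed {q : (ℝ × ℝ) × ℝ | 1 / 8 ≤ q.2} := isClosed_le (by fun_prop) (by fun_prop)
    have h2 : IsClosed {q : (ℝ × ℝ) × ℝ | q.2 ≤ 8} := isClosed_le (by fun_prop) (by fun_prop)
    have h3 : IsClosed {q : (ℝ × ℝ) × ℝ | |q.2 - 1| ≤ q.1.1} :=
      isClosed_le (by fun_prop) (by fun_prop)
    exact ((h1.inter h2).inter h3).measurableSet

theorem SquareFrostman.sliceEnergy_le {μ : Measure Plane} {α C : ℝ} (h : SquareFrostman μ α C)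
    (t τ w : ℝ) : sliceEnergy μ t w τ ≤ ENNReal.ofReal (2 * C ^ 2 * w) := by
  have hC := h.nonneg
  calc sliceEnergy μ t w τ ≤ ∫⁻ σ in radialSlice w, ENNReal.ofReal (C ^ 2) := by
        refine lintegral_mono fun σ => (power_le _ _).trans ?_
        rw [ENNReal.ofReal_pow hC]
        gcongr
        exact h.mass
    _ = ENNReal.ofReal (C ^ 2) * volume (radialSlice w) := setLIntegral_const _ _
    _ ≤ ENNReal.ofReal (C ^ 2) * volume (Set.Icc (1 - w) (1 + w)) := by
        gcongr
        intro σ hσ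
        have := abs_le.1 hσ.2
        constructor <;> linarith
    _ = _ := by
        rw [Real.volume_Icc, ← ENNReal.ofReal_mul (by positivity)]
        ring_nf

theorem circlePoint_add_pi (τ : ℝ) : circlePoint (τ + Real.pi) = -circlePoint τ := by
  ext i
  fin_cases i <;> simp [circlePoint]

/-- Since `μ` is real, `|μ̂|` is even. -/
theorem sliceEnergy_add_pi (μ : Measure Plane) (t w τ : ℝ) :
    sliceEnergy μ t w (τ + Real.pi) = sliceEnergy μ t w τ := by
  simp only [sliceEnergy, circlePoint_add_pi, smul_neg, power_neg]

/-! ### The angular integral at fixed `κ`. -/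

/-- The sector bound with opening `√κ x` and radial width `κ x`, weighted by `5 / (√κ κ x²)`. The
power of `κ` is `(2 - α)/2 + ε - 3/2 = (α - 5)/4`, above `-1` exactly because `ε = 3/4 (α - 1)`
exceeds `(α - 1)/2`. -/
theorem rpow_sector_identity {α κ t x : ℝ} (hκ : 0 < κ) (ht : 0 < t) (hx : 0 < x) (K : ℝ) :
    5 / (κ ^ (1 / 2 : ℝ) * κ * x ^ 2) * (K * (t ^ 2)⁻¹ * (t * (κ ^ (1 / 2 : ℝ) * x)) ^ (2 - α) *
      (t * (κ * x)) ^ (3 / 4 * (α - 1))) =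
    5 * K * κ ^ ((α - 5) / 4) * t ^ (-α + 3 / 4 * (α - 1)) * x ^ (-α + 3 / 4 * (α - 1)) := by
  have hs : 0 < κ ^ (1 / 2 : ℝ) := by positivity
  have e1 : κ ^ ((α - 5) / 4) = κ ^ ((1 / 2) * (2 - α)) * κ ^ (3 / 4 * (α - 1)) *
      (κ ^ (1 / 2 : ℝ))⁻¹ * κ⁻¹ := by
    rw [← Real.rpow_neg hκ.le, ← Real.rpow_neg_one κ, ← Real.rpow_add hκ, ← Real.rpow_add hκ,
      ← Real.rpow_add hκ]
    ring_nf
  have e2 : ∀ y : ℝ, 0 < y → y ^ (-α + 3 / 4 * (α - 1)) =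
      y ^ (2 - α) * y ^ (3 / 4 * (α - 1)) * (y ^ 2)⁻¹ := by
    intro y hy
    rw [← Real.rpow_natCast, ← Real.rpow_neg hy.le, ← Real.rpow_add hy, ← Real.rpow_add hy]
    congr 1
    push_cast
    ring
  rw [Real.mul_rpow ht.le (by positivity), Real.mul_rpow hs.le hx.le,
    Real.mul_rpow ht.le (by positivity), Real.mul_rpow hκ.le hx.le, ← Real.rpow_mul hκ.le, e1,
    e2 t ht, e2 x hx]
  generalize t ^ (2 - α) = u1
  generalize t ^ (3 / 4 * (α - 1)) = u2
  generalize x ^ (2 - α) = u3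
  generalize x ^ (3 / 4 * (α - 1)) = u4
  generalize κ ^ ((1 / 2) * (2 - α)) = u5
  generalize κ ^ (3 / 4 * (α - 1)) = u6
  field_simp

/-- A continuous decomposition into sectors: each `τ` is averaged over centres `c` with `|τ - c| ≤
√κ |τ| / 2`. After exchanging the integrals, the sector about each `c` is bounded by
`exists_lintegral_sector_le` and the powers of `|c|` are integrated. -/
theorem exists_lintegral_far_le (α C : ℝ) :
    ∃ K, 0 ≤ K ∧ ∀ (μ : Measure Plane), SquareFrostman μ α C →
      ∀ (t κ τ₁ : ℝ), 0 < t → 0 < κ → κ ≤ 1 →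
        ∫⁻ τ in {τ : ℝ | 1 / t < |τ| ∧ |τ| ≤ Real.pi / 2}, ENNReal.ofReal (2 / (κ * |τ|)) *
          sliceEnergy μ t (64 * (κ * |τ|)) (τ₁ + τ) ≤
          ENNReal.ofReal (K * κ ^ ((α - 5) / 4) / t) := by
  by_cases hα : 1 < α ∧ α ≤ 2
  swap
  · exact ⟨0, le_rfl, fun μ h => absurd ⟨h.one_lt, h.le_two⟩ hα⟩
  obtain ⟨hα1, hα2⟩ := hα
  set ε := 3 / 4 * (α - 1) with hε
  obtain ⟨K, hK, h⟩ := exists_lintegral_sector_le α C (ε := ε) (by linarith) (by linarith)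
  set p := -α + ε with hp
  have hp1 : p < -1 := by rw [hp, hε]; linarith
  have hp0 : 0 < -p - 1 := by linarith
  refine ⟨10 * K * (1 / 2) ^ (p + 1) / (-p - 1), by positivity,
    fun μ hμ t κ τ₁ ht hκ hκ1 => ?_⟩
  have := hμ.isFiniteMeasure
  set s := κ ^ (1 / 2 : ℝ) with hs
  have hs0 : 0 < s := by positivity
  have hs1 : s ≤ 1 := Real.rpow_le_one hκ.le hκ1 (by norm_num)
  have hs2 : s ^ 2 = κ := by
    rw [hs, ← Real.rpow_natCast, ← Real.rpow_mul hκ.le]; norm_num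
  have hκs : κ ≤ s := by nlinarith
  -- Since `√κ ≤ 1`, the averaging keeps `|c|` between `|τ| / 2` and `3 |τ| / 2`; hence the bounds
  -- `1 / (2 t)` and 3, the latter because `3π/4 < 3`.
  set Q : Set (ℝ × ℝ) := {q | 1 / (2 * t) < |q.2| ∧ |q.2| < 3 ∧ |q.1 - q.2| ≤ s * |q.2|} with hQ
  have hQm : MeasurableSet Q := by
    have h1 : MeasurableSet {q : ℝ × ℝ | 1 / (2 * t) < |q.2|} :=
      measurableSet_lt measurable_const (by fun_prop)
    have h2 : MeasurableSet {q : ℝ × ℝ | |q.2| < 3} :=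
      measurableSet_lt (by fun_prop) measurable_const
    have h3 : MeasurableSet {q : ℝ × ℝ | |q.1 - q.2| ≤ s * |q.2|} :=
      measurableSet_le (by fun_prop) (by fun_prop)
    exact h1.inter (h2.inter h3)
  set Φ : ℝ × ℝ → ℝ≥0∞ := Q.indicator fun q => ENNReal.ofReal (5 / (s * κ * |q.2| ^ 2)) *
    sliceEnergy μ t (128 * (κ * |q.2|)) (τ₁ + q.1) with hΦ
  have hΦm : Measurable Φ := by
    refine Measurable.indicator ?_ hQm
    have h1 : Measurable fun q : ℝ × ℝ => sliceEnergy μ t (128 * (κ * |q.2|)) (τ₁ + q.1) :=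
      (measurable_sliceEnergy μ t).comp
        (g := fun p : ℝ × ℝ => sliceEnergy μ t p.1 p.2)
        (f := fun q : ℝ × ℝ => (128 * (κ * |q.2|), τ₁ + q.1)) (by fun_prop)
    fun_prop
  have hfar : MeasurableSet {τ : ℝ | 1 / t < |τ| ∧ |τ| ≤ Real.pi / 2} := by
    have h1 : MeasurableSet {τ : ℝ | 1 / t < |τ|} := measurableSet_lt measurable_const (by fun_prop)
    have h2 : MeasurableSet {τ : ℝ | |τ| ≤ Real.pi / 2} :=
      measurableSet_le (by fun_prop) measurable_const
    exact h1.inter h2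
  have hpt : ∀ τ ∈ {τ : ℝ | 1 / t < |τ| ∧ |τ| ≤ Real.pi / 2},
      ENNReal.ofReal (2 / (κ * |τ|)) * sliceEnergy μ t (64 * (κ * |τ|)) (τ₁ + τ) ≤
        ∫⁻ c, Φ (τ, c) := by
    rintro τ ⟨h1, h2⟩
    have hτ : 0 < |τ| := lt_trans (by positivity) h1
    have hπ := Real.pi_lt_four
    calc ENNReal.ofReal (2 / (κ * |τ|)) * sliceEnergy μ t (64 * (κ * |τ|)) (τ₁ + τ)
        = ∫⁻ c in Set.Icc (τ - s * |τ| / 2) (τ + s * |τ| / 2), ENNReal.ofReal (1 / (s * |τ|)) *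
          (ENNReal.ofReal (2 / (κ * |τ|)) * sliceEnergy μ t (64 * (κ * |τ|)) (τ₁ + τ)) := by
          rw [setLIntegral_const, Real.volume_Icc, mul_right_comm, ← ENNReal.ofReal_mul
            (by positivity)]
          have : 1 / (s * |τ|) * (τ + s * |τ| / 2 - (τ - s * |τ| / 2)) = 1 := by
            field_simp; ring
          rw [this, ENNReal.ofReal_one, one_mul]
      _ ≤ ∫⁻ c in Set.Icc (τ - s * |τ| / 2) (τ + s * |τ| / 2), Φ (τ, c) := by
          refine setLIntegral_mono' measurableSet_Icc fun c hc => ?_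
          have hc1 : |τ - c| ≤ s * |τ| / 2 := abs_le.2 ⟨by linarith [hc.2], by linarith [hc.1]⟩
          have hc1' : |τ - c| ≤ |τ| / 2 := by nlinarith
          have hc2 : |τ| ≤ 2 * |c| := by
            have := abs_sub_abs_le_abs_sub τ c; linarith
          have hc3 : |c| ≤ 3 / 2 * |τ| := by
            have := abs_sub_abs_le_abs_sub c τ; rw [abs_sub_comm] at this; linarith
          have hc0 : 0 < |c| := by linarith
          have hmem : (τ, c) ∈ Q := by
            refine ⟨?_, ?_, ?_⟩
            · have : 1 / (2 * t) = 1 / t / 2 := by field_simp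
              simp only; linarith
            · have := Real.pi_lt_d2
              simp only; linarith
            · simp only; nlinarith
          rw [hΦ, Set.indicator_of_mem hmem, ← mul_assoc, ← ENNReal.ofReal_mul (by positivity)]
          simp only
          gcongr ?_ * ?_
          · apply ENNReal.ofReal_le_ofReal
            rw [div_mul_div_comm, div_le_div_iff₀ (by positivity) (by positivity)]
            have : |c| ^ 2 ≤ 9 / 4 * |τ| ^ 2 := by
              calc |c| ^ 2 ≤ (3 / 2 * |τ|) ^ 2 := by gcongr
                _ = _ := by ring
            have h3 : 0 < s * κ := by positivity
            calc 1 * 2 * (s * κ * |c| ^ 2) = 2 * (s * κ) * |c| ^ 2 := by ring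
              _ ≤ 2 * (s * κ) * (9 / 4 * |τ| ^ 2) := by gcongr
              _ ≤ 5 * (s * |τ| * (κ * |τ|)) := by
                nlinarith [sq_nonneg |τ|, mul_pos h3 (pow_pos hτ 2)]
          · apply sliceEnergy_mono
            nlinarith
      _ ≤ _ := setLIntegral_le_lintegral _ _
  have hc : ∀ c : ℝ, ∫⁻ τ, Φ (τ, c) ≤ (Set.Ioi (1 / (2 * t))).indicator (fun x =>
      ENNReal.ofReal (5 * K * κ ^ ((α - 5) / 4) * t ^ p * x ^ p)) |c| := by
    intro c
    by_cases hc1 : 1 / (2 * t) < |c| ∧ |c| < 3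
    swap
    · have : ∀ τ, Φ (τ, c) = 0 := fun τ => by
        rw [hΦ, Set.indicator_of_notMem]
        exact fun hm => hc1 ⟨hm.1, hm.2.1⟩
      simp [this]
    obtain ⟨hc1, hc3⟩ := hc1
    have hc0 : 0 < |c| := lt_trans (by positivity) hc1
    have e : ∀ τ, Φ (τ, c) = ENNReal.ofReal (5 / (s * κ * |c| ^ 2)) *
        (Set.Icc (-(s * |c|)) (s * |c|)).indicator
          (fun τ => sliceEnergy μ t (128 * (κ * |c|)) (τ₁ + c + τ)) (τ - c) := by
      intro τ
      rw [hΦ]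
      by_cases hm : |τ - c| ≤ s * |c|
      · rw [Set.indicator_of_mem (show (τ, c) ∈ Q from ⟨hc1, hc3, hm⟩),
          Set.indicator_of_mem (show τ - c ∈ Set.Icc _ _ from abs_le.1 hm)]
        simp only
        congr 2
        ring
      · rw [Set.indicator_of_notMem (fun h => hm h.2.2),
          Set.indicator_of_notMem (s := Set.Icc _ _) (fun h => hm (abs_le.2 h)), mul_zero]
    simp_rw [e]
    rw [lintegral_const_mul' _ _ ENNReal.ofReal_ne_top,
      lintegral_sub_right_eq_self ((Set.Icc (-(s * |c|)) (s * |c|)).indicator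
          (fun τ => sliceEnergy μ t (128 * (κ * |c|)) (τ₁ + c + τ))) c,
      lintegral_indicator measurableSet_Icc, Set.indicator_of_mem (show |c| ∈ Set.Ioi _ from hc1),
      ← rpow_sector_identity hκ ht hc0, ENNReal.ofReal_mul (by positivity)]
    gcongr
    refine h μ hμ t (τ₁ + c) (s * |c|) (κ * |c|) ht (by positivity) (by gcongr) ?_ ?_
    · have := Real.pi_gt_three; nlinarith
    -- The sector condition reads `κ c² ≤ 4 κ |c|`, true because `|c| < 3`.
    · rw [mul_pow, hs2]; nlinarith [mul_pos hκ hc0]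
  calc ∫⁻ τ in {τ : ℝ | 1 / t < |τ| ∧ |τ| ≤ Real.pi / 2}, ENNReal.ofReal (2 / (κ * |τ|)) *
          sliceEnergy μ t (64 * (κ * |τ|)) (τ₁ + τ)
      ≤ ∫⁻ τ in {τ : ℝ | 1 / t < |τ| ∧ |τ| ≤ Real.pi / 2}, ∫⁻ c, Φ (τ, c) :=
        setLIntegral_mono' hfar hpt
    _ ≤ ∫⁻ τ, ∫⁻ c, Φ (τ, c) := setLIntegral_le_lintegral _ _
    _ = ∫⁻ c, ∫⁻ τ, Φ (τ, c) := lintegral_lintegral_swap hΦm.aemeasurable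
    _ ≤ ∫⁻ c, (Set.Ioi (1 / (2 * t))).indicator (fun x =>
          ENNReal.ofReal (5 * K * κ ^ ((α - 5) / 4) * t ^ p * x ^ p)) |c| := lintegral_mono hc
    _ = 2 * ∫⁻ c in Set.Ioi (1 / (2 * t)),
          ENNReal.ofReal (5 * K * κ ^ ((α - 5) / 4) * t ^ p * c ^ p) := by
        rw [lintegral_eq_two_mul_of_even (by simp)]
        congr 1
        rw [← lintegral_indicator measurableSet_Ioi, ← lintegral_indicator measurableSet_Ioi]
        congr 1; ext c
        have ht2 : 0 < 1 / (2 * t) := by positivity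
        by_cases hc : 0 < c
        · rw [Set.indicator_of_mem (show c ∈ Set.Ioi 0 from hc), abs_of_pos hc]
        · rw [Set.indicator_of_notMem (show c ∉ Set.Ioi 0 from hc), Set.indicator_of_notMem]
          simp only [Set.mem_Ioi]; linarith
    -- Convergence at infinity is `p < -1`, that is `ε < α - 1`. The lower limit gives `t ^ (-p -
    -- 1)`, which combines with `t ^ p` to `1 / t`.
    _ = 2 * (ENNReal.ofReal (5 * K * κ ^ ((α - 5) / 4) * t ^ p) *
          ENNReal.ofReal ((1 / (2 * t)) ^ (p + 1) / (-p - 1))) := by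
        rw [← setLIntegral_Ioi_rpow hp1 (by positivity),
          ← lintegral_const_mul' _ _ ENNReal.ofReal_ne_top]
        congr 2; ext c
        rw [← ENNReal.ofReal_mul (by positivity)]
    _ = _ := by
        rw [← ENNReal.ofReal_mul (by positivity), ← ENNReal.ofReal_ofNat,
          ← ENNReal.ofReal_mul (by positivity)]
        congr 1
        have e1 : (1 / (2 * t)) ^ (p + 1) = (1 / 2) ^ (p + 1) * (t ^ p)⁻¹ * t⁻¹ := by
          rw [← div_div, Real.div_rpow (by norm_num) ht.le, Real.rpow_add_one ht.ne']
          field_simp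
        rw [e1]
        have : 0 < t ^ p := by positivity
        field_simp
        ring

/-- The angular integral of normalized slice energies of width `κ |sin τ|` decays like `1 / t`. -/
theorem exists_lintegral_sliceEnergy_le (α C : ℝ) :
    ∃ K, 0 ≤ K ∧ ∀ (μ : Measure Plane), SquareFrostman μ α C →
      ∀ (t κ τ₁ : ℝ), 0 < t → 0 < κ → κ ≤ 1 →
        ∫⁻ τ in Set.Ioc (-(Real.pi / 2)) (Real.pi / 2), ENNReal.ofReal (1 / (κ * |Real.sin τ|)) *
          sliceEnergy μ t (64 * (κ * |Real.sin τ|)) (τ₁ + τ) ≤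
          ENNReal.ofReal (K * κ ^ ((α - 5) / 4) / t) := by
  obtain ⟨K, hK, h⟩ := exists_lintegral_far_le α C
  refine ⟨512 * C ^ 2 + K, by positivity, fun μ hμ t κ τ₁ ht hκ hκ1 => ?_⟩
  have := hμ.isFiniteMeasure
  have hpt : ∀ τ ∈ Set.Ioc (-(Real.pi / 2)) (Real.pi / 2),
      ENNReal.ofReal (1 / (κ * |Real.sin τ|)) *
        sliceEnergy μ t (64 * (κ * |Real.sin τ|)) (τ₁ + τ) ≤
      ENNReal.ofReal (2 / (κ * |τ|)) * sliceEnergy μ t (64 * (κ * |τ|)) (τ₁ + τ) := by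
    intro τ hτ
    -- At `τ = 0` both weights are `1 / 0 = 0`.
    rcases eq_or_ne τ 0 with rfl | h0
    · simp
    have hτ0 : 0 < |τ| := abs_pos.2 h0
    have h1 := Real.mul_abs_le_abs_sin (x := τ) (abs_le.2 ⟨hτ.1.le, hτ.2⟩)
    have h2 : |τ| ≤ 2 * |Real.sin τ| := by
      have h3 : (1 / 2 : ℝ) ≤ 2 / Real.pi := by
        rw [div_le_div_iff₀ two_pos Real.pi_pos]; linarith [Real.pi_lt_four]
      nlinarith
    have h4 : 0 < |Real.sin τ| := by linarith
    gcongr ?_ * ?_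
    · apply ENNReal.ofReal_le_ofReal
      rw [div_le_div_iff₀ (by positivity) (by positivity)]
      nlinarith
    · apply sliceEnergy_mono
      have : |Real.sin τ| ≤ |τ| := Real.abs_sin_le_abs
      nlinarith
  -- The weight cancels the width in the trivial bound, so the window `|τ| ≤ 1 / t` contributes `O(1
  -- / t)`.
  have hnear : ∀ τ : ℝ, ENNReal.ofReal (2 / (κ * |τ|)) *
      sliceEnergy μ t (64 * (κ * |τ|)) (τ₁ + τ) ≤ ENNReal.ofReal (256 * C ^ 2) := by
    intro τ
    rcases eq_or_ne τ 0 with rfl | h0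
    · simp
    have hτ0 : 0 < |τ| := abs_pos.2 h0
    grw [hμ.sliceEnergy_le t (τ₁ + τ) (64 * (κ * |τ|))]
    rw [← ENNReal.ofReal_mul (by positivity)]
    apply ENNReal.ofReal_le_ofReal
    apply le_of_eq
    field_simp
    ring
  have hsub : Set.Ioc (-(Real.pi / 2)) (Real.pi / 2) ⊆ Set.Icc (-(1 / t)) (1 / t) ∪
      {τ : ℝ | 1 / t < |τ| ∧ |τ| ≤ Real.pi / 2} := by
    intro τ hτ
    rcases le_or_gt |τ| (1 / t) with h1 | h1
    · exact Or.inl (abs_le.1 h1)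
    · exact Or.inr ⟨h1, abs_le.2 ⟨hτ.1.le, hτ.2⟩⟩
  calc _ ≤ ∫⁻ τ in Set.Ioc (-(Real.pi / 2)) (Real.pi / 2), ENNReal.ofReal (2 / (κ * |τ|)) *
          sliceEnergy μ t (64 * (κ * |τ|)) (τ₁ + τ) := setLIntegral_mono' measurableSet_Ioc hpt
    _ ≤ (∫⁻ τ in Set.Icc (-(1 / t)) (1 / t), ENNReal.ofReal (2 / (κ * |τ|)) *
          sliceEnergy μ t (64 * (κ * |τ|)) (τ₁ + τ)) +
        ∫⁻ τ in {τ : ℝ | 1 / t < |τ| ∧ |τ| ≤ Real.pi / 2}, ENNReal.ofReal (2 / (κ * |τ|)) *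
          sliceEnergy μ t (64 * (κ * |τ|)) (τ₁ + τ) :=
        (lintegral_mono_set hsub).trans (lintegral_union_le _ _ _)
    _ ≤ (∫⁻ τ in Set.Icc (-(1 / t)) (1 / t), ENNReal.ofReal (256 * C ^ 2)) +
        ENNReal.ofReal (K * κ ^ ((α - 5) / 4) / t) := by
        gcongr
        · exact hnear _
        · exact h μ hμ t κ τ₁ ht hκ hκ1
    _ ≤ _ := by
        rw [setLIntegral_const, Real.volume_Icc, ← ENNReal.ofReal_mul (by positivity),
          ← ENNReal.ofReal_add (by apply mul_nonneg (by positivity); ring_nf; positivity)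
            (by positivity)]
        apply ENNReal.ofReal_le_ofReal
        have hκp : 1 ≤ κ ^ ((α - 5) / 4) :=
          Real.one_le_rpow_of_pos_of_le_one_of_nonpos hκ hκ1 (by linarith [hμ.le_two])
        rw [add_mul, add_div]
        gcongr ?_ + _
        calc 256 * C ^ 2 * (1 / t - -(1 / t)) = 512 * C ^ 2 * 1 / t := by ring
          _ ≤ _ := by gcongr

/-! ### Motion of an ellipse point as the second semi-axis varies. -/

/-- The value at the unit vector of angle `x` of the gauge of the ellipse with semi-axes `a`. -/
def ellipseGauge (a : ℝ × ℝ) (x : ℝ) : ℝ := √((Real.cos x / a.1) ^ 2 + (Real.sin x / a.2) ^ 2)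

@[fun_prop]
theorem measurable_ellipseGauge {β : Type*} [MeasurableSpace β] {f : β → ℝ × ℝ} {g : β → ℝ}
    (hf : Measurable f) (hg : Measurable g) : Measurable fun b => ellipseGauge (f b) (g b) := by
  unfold ellipseGauge; fun_prop

theorem one_div_sq_mem_Icc {u : ℝ} (hu : u ∈ Set.Icc (1 / 2 : ℝ) 4) :
    (u ^ 2)⁻¹ ∈ Set.Icc (1 / 16 : ℝ) 4 := by
  have h0 : 0 < u := by linarith [hu.1]
  constructor
  · rw [one_div]; gcongr; nlinarith [hu.2]
  · rw [inv_le_comm₀ (by positivity) (by norm_num)]; nlinarith [hu.1]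

theorem ellipseGauge_sq {a : ℝ × ℝ} (x : ℝ) :
    ellipseGauge a x ^ 2 = (a.1 ^ 2)⁻¹ + ((a.2 ^ 2)⁻¹ - (a.1 ^ 2)⁻¹) * Real.sin x ^ 2 := by
  rw [ellipseGauge, Real.sq_sqrt (by positivity)]
  have h := Real.sin_sq_add_cos_sq x
  rw [div_pow, div_pow, div_eq_mul_inv, div_eq_mul_inv]
  linear_combination (a.1 ^ 2)⁻¹ * h

theorem ellipseGauge_mem_Icc {a : ℝ × ℝ}
    (ha : a ∈ Set.Icc (1 / 2 : ℝ) 4 ×ˢ Set.Icc (1 / 2 : ℝ) 4) (x : ℝ) :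
    ellipseGauge a x ∈ Set.Icc (1 / 4 : ℝ) 2 := by
  have h := ellipseGauge_sq (a := a) x
  have h1 := one_div_sq_mem_Icc ha.1
  have h2 := one_div_sq_mem_Icc ha.2
  have h3 : 0 ≤ ellipseGauge a x := Real.sqrt_nonneg _
  have h4 := Real.sin_sq_le_one x
  have h5 := sq_nonneg (Real.sin x)
  simp only [Set.mem_Icc] at h1 h2
  constructor
  · apply le_of_sq_le_sq _ h3
    rw [h]
    nlinarith
  · apply le_of_sq_le_sq _ two_pos.le
    rw [h]
    nlinarith

theorem ellipseGauge_div_mem_radialSlice {a : ℝ × ℝ}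
    (ha : a ∈ Set.Icc (1 / 2 : ℝ) 4 ×ˢ Set.Icc (1 / 2 : ℝ) 4) (x y : ℝ) :
    ellipseGauge a x / ellipseGauge a y ∈
      radialSlice (64 * |Real.sin x ^ 2 - Real.sin y ^ 2|) := by
  obtain ⟨hx1, hx2⟩ := ellipseGauge_mem_Icc ha x
  obtain ⟨hy1, hy2⟩ := ellipseGauge_mem_Icc ha y
  have ex := ellipseGauge_sq (a := a) x
  have ey := ellipseGauge_sq (a := a) y
  have h1 := one_div_sq_mem_Icc ha.1
  have h2 := one_div_sq_mem_Icc ha.2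
  simp only [Set.mem_Icc] at h1 h2
  set n := ellipseGauge a x
  set m := ellipseGauge a y
  have hm : 0 < m := by linarith
  refine ⟨⟨?_, ?_⟩, ?_⟩
  · rw [le_div_iff₀ hm]; linarith
  · rw [div_le_iff₀ hm]; linarith
  · rw [div_sub_one hm.ne', abs_div, abs_of_pos hm, div_le_iff₀ hm]
    have e1 : (n - m) * (n + m) = ((a.2 ^ 2)⁻¹ - (a.1 ^ 2)⁻¹) *
        (Real.sin x ^ 2 - Real.sin y ^ 2) := by linear_combination ex - ey
    have e2 : |n - m| * (n + m) ≤ 4 * |Real.sin x ^ 2 - Real.sin y ^ 2| := by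
      rw [← abs_of_nonneg (show 0 ≤ n + m by linarith), ← abs_mul, e1, abs_mul]
      gcongr
      rw [abs_le]; constructor <;> linarith
    have e3 := abs_nonneg (n - m)
    have e4 := abs_nonneg (Real.sin x ^ 2 - Real.sin y ^ 2)
    nlinarith

/-- In the numerator of the quotient rule the terms carrying the second semi-axis cancel, leaving a
multiple of `sin² x - sin² y`. -/
theorem hasDerivAt_ellipseGauge_div {a₁ u : ℝ} (ha : a₁ ∈ Set.Icc (1 / 2 : ℝ) 4)
    (hu : u ∈ Set.Icc (1 / 2 : ℝ) 4) (x y : ℝ) :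
    HasDerivAt (fun v => ellipseGauge (a₁, v) x / ellipseGauge (a₁, v) y)
      (-((a₁ ^ 2)⁻¹ * (Real.sin x ^ 2 - Real.sin y ^ 2)) /
        (u ^ 3 * ellipseGauge (a₁, u) x * ellipseGauge (a₁, u) y ^ 3)) u := by
  have hu0 : 0 < u := by linarith [hu.1]
  have ha0 : 0 < a₁ := by linarith [ha.1]
  have hmem : ((a₁, u) : ℝ × ℝ) ∈ Set.Icc (1 / 2 : ℝ) 4 ×ˢ Set.Icc (1 / 2 : ℝ) 4 := ⟨ha, hu⟩
  have hpos : ∀ z, 0 < ellipseGauge (a₁, u) z := fun z => by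
    linarith [(ellipseGauge_mem_Icc hmem z).1]
  have hd : ∀ z, HasDerivAt (fun v => ellipseGauge (a₁, v) z)
      (-(2 * Real.sin z ^ 2 / u ^ 3) / (2 * ellipseGauge (a₁, u) z)) u := by
    intro z
    have h1 : HasDerivAt (fun v : ℝ => (Real.cos z / a₁) ^ 2 + (Real.sin z / v) ^ 2)
        (-(2 * Real.sin z ^ 2 / u ^ 3)) u := by
      have h2 : HasDerivAt (fun v : ℝ => Real.sin z / v) (-(Real.sin z / u ^ 2)) u := by
        refine ((hasDerivAt_const u (Real.sin z)).div (hasDerivAt_id u) hu0.ne').congr_deriv ?_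
        simp [neg_div]
      refine ((h2.pow 2).const_add ((Real.cos z / a₁) ^ 2)).congr_deriv ?_
      simp
      field_simp
    have h3 := h1.sqrt (by
      have := hpos z
      rw [ellipseGauge, Real.sqrt_pos] at this
      exact this.ne')
    exact h3
  refine ((hd x).div (hd y) (hpos y).ne').congr_deriv ?_
  have ex := ellipseGauge_sq (a := (a₁, u)) x
  have ey := ellipseGauge_sq (a := (a₁, u)) y
  have hx := hpos x
  have hy := hpos y
  simp only at ex ey
  set n := ellipseGauge (a₁, u) x
  set m := ellipseGauge (a₁, u) y
  have e : (a₁ ^ 2)⁻¹ * (Real.sin x ^ 2 - Real.sin y ^ 2) =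
      Real.sin x ^ 2 * m ^ 2 - Real.sin y ^ 2 * n ^ 2 := by
    rw [ex, ey]; ring
  rw [e]
  field_simp
  ring

/-- The squared ratio is a Möbius function of `v⁻²` whose determinant is a nonzero multiple of `sin²
x - sin² y`. -/
theorem injOn_ellipseGauge_div {a₁ : ℝ} (ha : a₁ ∈ Set.Icc (1 / 2 : ℝ) 4) {x y : ℝ}
    (hD : Real.sin x ^ 2 - Real.sin y ^ 2 ≠ 0) :
    Set.InjOn (fun v => ellipseGauge (a₁, v) x / ellipseGauge (a₁, v) y)
      (Set.Icc (1 / 2 : ℝ) 4) := by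
  intro u hu v hv h
  have hu0 : 0 < u := by linarith [hu.1]
  have hv0 : 0 < v := by linarith [hv.1]
  have ha0 : 0 < a₁ := by linarith [ha.1]
  have hm1 : 0 < ellipseGauge (a₁, u) y := by
    linarith [(ellipseGauge_mem_Icc (a := (a₁, u)) ⟨ha, hu⟩ y).1]
  have hm2 : 0 < ellipseGauge (a₁, v) y := by
    linarith [(ellipseGauge_mem_Icc (a := (a₁, v)) ⟨ha, hv⟩ y).1]
  simp only at h
  rw [div_eq_div_iff hm1.ne' hm2.ne'] at h
  have h2 : ellipseGauge (a₁, u) x ^ 2 * ellipseGauge (a₁, v) y ^ 2 =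
      ellipseGauge (a₁, v) x ^ 2 * ellipseGauge (a₁, u) y ^ 2 := by
    rw [← mul_pow, h, mul_pow]
  simp only [ellipseGauge_sq] at h2
  have h3 : ((a₁ ^ 2)⁻¹ * (Real.sin x ^ 2 - Real.sin y ^ 2)) * ((u ^ 2)⁻¹ - (v ^ 2)⁻¹) = 0 := by
    linear_combination h2
  have h4 : (u ^ 2)⁻¹ = (v ^ 2)⁻¹ := by
    have := (mul_eq_zero.1 h3).resolve_left (mul_ne_zero (by positivity) hD)
    linarith
  exact (pow_left_inj₀ hu0.le hv0.le two_ne_zero).1 (inv_injective h4)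

/-- Change of variables from the second semi-axis to the ratio `σ`. The derivative is at least `|D|
/ (16 * 1024)` in modulus, `1024 = 4³ * 2 * 2³` bounding its denominator. -/
theorem setLIntegral_comp_ellipseGauge_div_le {a₁ : ℝ} (ha : a₁ ∈ Set.Icc (1 / 2 : ℝ) 4) {x y : ℝ}
    (hD : Real.sin x ^ 2 - Real.sin y ^ 2 ≠ 0) (g : ℝ → ℝ≥0∞) :
    ∫⁻ u in Set.Icc (1 / 2 : ℝ) 4, g (ellipseGauge (a₁, u) x / ellipseGauge (a₁, u) y) ≤
      ENNReal.ofReal (16384 / |Real.sin x ^ 2 - Real.sin y ^ 2|) *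
        ∫⁻ σ in radialSlice (64 * |Real.sin x ^ 2 - Real.sin y ^ 2|), g σ := by
  set D := Real.sin x ^ 2 - Real.sin y ^ 2 with hDdef
  have hD0 : 0 < |D| := abs_pos.2 hD
  have himg := lintegral_image_eq_lintegral_abs_deriv_mul measurableSet_Icc
    (fun u hu => (hasDerivAt_ellipseGauge_div ha hu x y).hasDerivWithinAt)
    (injOn_ellipseGauge_div ha hD) g
  have hsub : (fun v => ellipseGauge (a₁, v) x / ellipseGauge (a₁, v) y) '' Set.Icc (1 / 2 : ℝ) 4 ⊆
      radialSlice (64 * |D|) := by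
    rintro _ ⟨u, hu, rfl⟩
    exact ellipseGauge_div_mem_radialSlice (a := (a₁, u)) ⟨ha, hu⟩ x y
  refine le_trans ?_ (mul_le_mul_right (lintegral_mono_set hsub) _)
  rw [himg, ← lintegral_const_mul' _ _ ENNReal.ofReal_ne_top]
  refine setLIntegral_mono' measurableSet_Icc fun u hu => ?_
  rw [← mul_assoc, ← ENNReal.ofReal_mul (by positivity)]
  apply le_mul_of_one_le_left'
  rw [← ENNReal.ofReal_one]
  apply ENNReal.ofReal_le_ofReal
  obtain ⟨hx1, hx2⟩ := ellipseGauge_mem_Icc (a := (a₁, u)) ⟨ha, hu⟩ x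
  obtain ⟨hy1, hy2⟩ := ellipseGauge_mem_Icc (a := (a₁, u)) ⟨ha, hu⟩ y
  have hu0 : 0 < u := by linarith [hu.1]
  have hp := (one_div_sq_mem_Icc ha).1
  set n := ellipseGauge (a₁, u) x
  set m := ellipseGauge (a₁, u) y
  have hn0 : 0 < n := by linarith
  have hm0 : 0 < m := by linarith
  have hp0 : 0 < (a₁ ^ 2)⁻¹ := by linarith
  have hden : u ^ 3 * n * m ^ 3 ≤ 4 ^ 3 * 2 * 2 ^ 3 := by
    have := hu.2
    gcongr
  rw [← hDdef, abs_div, abs_neg, abs_mul, abs_of_pos hp0,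
    abs_of_pos (show 0 < u ^ 3 * n * m ^ 3 by positivity), div_mul_div_comm,
    le_div_iff₀ (by positivity)]
  nlinarith

theorem sin_sq_sub_sin_sq (x y : ℝ) :
    Real.sin x ^ 2 - Real.sin y ^ 2 = Real.sin (x + y) * Real.sin (x - y) := by
  rw [Real.sin_add, Real.sin_sub]
  linear_combination -Real.sin x ^ 2 * Real.sin_sq_add_cos_sq y +
    Real.sin y ^ 2 * Real.sin_sq_add_cos_sq x

/-! ### Averaging over the ellipses through a point. -/

theorem ae_sin_ne_zero {f : ℝ → ℝ} (hf : Function.Injective f) : ∀ᵐ x, Real.sin (f x) ≠ 0 := by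
  have h : {x : ℝ | Real.sin (f x) = 0}.Countable := by
    have : {x : ℝ | Real.sin (f x) = 0} = f ⁻¹' Set.range fun n : ℤ => n * Real.pi := by
      ext x
      simp [Real.sin_eq_zero_iff]
    rw [this]
    exact (Set.countable_range _).preimage hf
  have := h.ae_notMem volume
  simpa using this

theorem lintegral_abs_rpow_lt_top {q : ℝ} (hq : -1 < q) (r : ℝ) :
    ∫⁻ x in Set.Ioc (-r) r, ENNReal.ofReal (|x| ^ q) < ∞ := by
  have h1 : ∫⁻ x in Set.Ioc 0 r, ENNReal.ofReal (x ^ q) < ∞ := by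
    rcases le_or_gt r 0 with hr | hr
    · simp [Set.Ioc_eq_empty_of_le hr]
    have h := (intervalIntegral.intervalIntegrable_rpow' hq (a := 0) (b := r)).1
    exact h.lintegral_lt_top
  have h2 : ∫⁻ x in Set.Ioc (-r) r, ENNReal.ofReal (|x| ^ q) ≤
      ∫⁻ x, (Set.Iic r).indicator (fun y => ENNReal.ofReal (y ^ q)) |x| := by
    rw [← lintegral_indicator measurableSet_Ioc]
    refine lintegral_mono fun x => ?_
    by_cases hx : x ∈ Set.Ioc (-r) r
    · have : |x| ∈ Set.Iic r := abs_le.2 ⟨hx.1.le, hx.2⟩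
      rw [Set.indicator_of_mem hx, Set.indicator_of_mem this]
    · rw [Set.indicator_of_notMem hx]; exact zero_le
  refine h2.trans_lt ?_
  rw [lintegral_eq_two_mul_of_even (by simp)]
  refine ENNReal.mul_lt_top (by simp) (lt_of_le_of_lt (le_of_eq ?_) h1)
  rw [← lintegral_indicator measurableSet_Ioi, ← lintegral_indicator measurableSet_Ioc]
  congr 1; ext x
  by_cases hx : 0 < x
  · simp [Set.indicator, hx, abs_of_pos hx]
  · simp [Set.indicator, hx]

theorem exists_lintegral_abs_sin_rpow_le {q : ℝ} (hq : -1 < q) (hq0 : q ≤ 0) :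
    ∃ K, 0 ≤ K ∧ ∫⁻ φ in Set.Ioc 0 Real.pi, ENNReal.ofReal (|Real.sin (2 * φ)| ^ q) ≤
      ENNReal.ofReal K := by
  have hfin := lintegral_abs_rpow_lt_top hq (Real.pi / 2 / 2)
  refine ⟨(2 * ∫⁻ x in Set.Ioc (-(Real.pi / 2 / 2)) (Real.pi / 2 / 2),
    ENNReal.ofReal (|x| ^ q)).toReal, ENNReal.toReal_nonneg, ?_⟩
  rw [ENNReal.ofReal_toReal (ENNReal.mul_lt_top (by simp) hfin).ne]
  -- Two periods fill `(0, π]`, and on the centred period `|sin 2φ|` is at least `|φ|`, so only the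
  -- singularity at 0 matters.
  have hper : Function.Periodic (fun φ => ENNReal.ofReal (|Real.sin (2 * φ)| ^ q))
      (Real.pi / 2) := by
    intro φ
    simp only
    rw [mul_add, mul_div_cancel₀ _ two_ne_zero, Real.sin_add_pi, abs_neg]
  have h := periodic_setLIntegral_Ioc_two_mul hper (by have := Real.pi_pos; positivity)
  rw [mul_div_cancel₀ _ two_ne_zero] at h
  rw [h]
  gcongr 2 * ?_
  refine setLIntegral_mono' measurableSet_Ioc fun φ hφ => ENNReal.ofReal_le_ofReal ?_
  rcases eq_or_ne φ 0 with rfl | h0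
  · simp
  have hφ0 : 0 < |φ| := abs_pos.2 h0
  refine Real.rpow_le_rpow_of_nonpos hφ0 ?_ hq0
  have h1 := Real.mul_abs_le_abs_sin (x := 2 * φ)
    (abs_le.2 ⟨by linarith [hφ.1], by linarith [hφ.2]⟩)
  rw [abs_mul, abs_two] at h1
  have h3 : (1 / 2 : ℝ) ≤ 2 / Real.pi := by
    rw [div_le_div_iff₀ two_pos Real.pi_pos]; linarith [Real.pi_lt_four]
  nlinarith

/-- `sliceEnergy` normalized by the width of the segment. -/
def normalizedSliceEnergy (μ : Measure Plane) (t d τ : ℝ) : ℝ≥0∞ :=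
  ENNReal.ofReal (1 / d) * sliceEnergy μ t (64 * d) τ

theorem measurable_normalizedSliceEnergy (μ : Measure Plane) [IsFiniteMeasure μ] (t : ℝ)
    {β : Type*} [MeasurableSpace β] {f g : β → ℝ} (hf : Measurable f) (hg : Measurable g) :
    Measurable fun b => normalizedSliceEnergy μ t (f b) (g b) := by
  have h1 : Measurable fun b => sliceEnergy μ t (64 * f b) (g b) :=
    (measurable_sliceEnergy μ t).comp (g := fun p : ℝ × ℝ => sliceEnergy μ t p.1 p.2)
      (f := fun b => (64 * f b, g b)) (by fun_prop)
  unfold normalizedSliceEnergy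
  fun_prop

/-- Only the second semi-axis is used to move the point; the first contributes the length `7 / 2` of
its range. -/
theorem setLIntegral_power_ellipse_le (μ : Measure Plane) [IsFiniteMeasure μ] (t τ₁ τ φ : ℝ)
    (h1 : Real.sin (τ₁ - τ) ≠ 0) (h2 : Real.sin (τ₁ + τ - 2 * φ) ≠ 0) :
    ∫⁻ a in Set.Icc (1 / 2 : ℝ) 4 ×ˢ Set.Icc (1 / 2 : ℝ) 4,
      power μ ((t * (ellipseGauge a (τ₁ - φ) / ellipseGauge a (τ - φ))) • circlePoint τ) ≤
      ENNReal.ofReal 65536 *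
        normalizedSliceEnergy μ t (|Real.sin (τ₁ + τ - 2 * φ)| * |Real.sin (τ₁ - τ)|) τ := by
  have hD : Real.sin (τ₁ - φ) ^ 2 - Real.sin (τ - φ) ^ 2 =
      Real.sin (τ₁ + τ - 2 * φ) * Real.sin (τ₁ - τ) := by
    rw [sin_sq_sub_sin_sq]; ring_nf
  rw [Measure.volume_eq_prod, setLIntegral_prod]
  swap
  · exact ((measurable_power μ).comp (by fun_prop)).aemeasurable
  calc ∫⁻ a₁ in Set.Icc (1 / 2 : ℝ) 4, ∫⁻ u in Set.Icc (1 / 2 : ℝ) 4,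
        power μ ((t * (ellipseGauge (a₁, u) (τ₁ - φ) / ellipseGauge (a₁, u) (τ - φ))) •
          circlePoint τ)
      ≤ ∫⁻ a₁ in Set.Icc (1 / 2 : ℝ) 4, ENNReal.ofReal 16384 *
        normalizedSliceEnergy μ t (|Real.sin (τ₁ + τ - 2 * φ)| * |Real.sin (τ₁ - τ)|) τ := by
        refine setLIntegral_mono' measurableSet_Icc fun a₁ ha => ?_
        refine (setLIntegral_comp_ellipseGauge_div_le ha (x := τ₁ - φ) (y := τ - φ)
          (by rw [hD]; exact mul_ne_zero h2 h1)
          (fun σ => power μ ((t * σ) • circlePoint τ))).trans (le_of_eq ?_)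
        rw [hD, abs_mul, normalizedSliceEnergy, sliceEnergy,
          ← mul_assoc (ENNReal.ofReal 16384),
          ← ENNReal.ofReal_mul (by norm_num), mul_one_div]
    _ = ENNReal.ofReal 16384 * ENNReal.ofReal (7 / 2) * normalizedSliceEnergy μ t
          (|Real.sin (τ₁ + τ - 2 * φ)| * |Real.sin (τ₁ - τ)|) τ := by
        rw [setLIntegral_const, Real.volume_Icc, mul_right_comm]
        norm_num
    _ ≤ _ := by
        rw [← ENNReal.ofReal_mul (by norm_num)]
        gcongr
        norm_num

/-- The average over ellipses through a point at distance `t` from the origin of the mean square of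
the Fourier transform over the ellipse is at most a constant times `1 / t`. -/
theorem exists_lintegral_ellipses_le (α C : ℝ) :
    ∃ K, 0 ≤ K ∧ ∀ (μ : Measure Plane), SquareFrostman μ α C → ∀ (t τ₁ : ℝ), 0 < t →
      ∫⁻ φ in Set.Ioc 0 Real.pi, ∫⁻ a in Set.Icc (1 / 2 : ℝ) 4 ×ˢ Set.Icc (1 / 2 : ℝ) 4,
        ∫⁻ τ in Set.Ioc 0 (2 * Real.pi),
          power μ ((t * (ellipseGauge a (τ₁ - φ) / ellipseGauge a (τ - φ))) • circlePoint τ) ≤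
        ENNReal.ofReal (K / t) := by
  by_cases hα : 1 < α ∧ α ≤ 2
  swap
  · exact ⟨0, le_rfl, fun μ h => absurd ⟨h.one_lt, h.le_two⟩ hα⟩
  obtain ⟨K₁, hK₁, h₁⟩ := exists_lintegral_sliceEnergy_le α C
  obtain ⟨K₂, hK₂, h₂⟩ := exists_lintegral_abs_sin_rpow_le (q := (α - 5) / 4)
    (by linarith [hα.1]) (by linarith [hα.2])
  refine ⟨65536 * (2 * K₁ * K₂), by positivity, fun μ hμ t τ₁ ht => ?_⟩
  have := hμ.isFiniteMeasure
  have hπ := Real.pi_pos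
  set N := normalizedSliceEnergy μ t with hN
  have hNπ : ∀ d τ, N d (τ + Real.pi) = N d τ := fun d τ => by
    rw [hN, normalizedSliceEnergy, normalizedSliceEnergy, sliceEnergy_add_pi]
  calc ∫⁻ φ in Set.Ioc 0 Real.pi, ∫⁻ a in Set.Icc (1 / 2 : ℝ) 4 ×ˢ Set.Icc (1 / 2 : ℝ) 4,
        ∫⁻ τ in Set.Ioc 0 (2 * Real.pi),
          power μ ((t * (ellipseGauge a (τ₁ - φ) / ellipseGauge a (τ - φ))) • circlePoint τ)
      = ∫⁻ φ in Set.Ioc 0 Real.pi, ∫⁻ τ in Set.Ioc 0 (2 * Real.pi),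
        ∫⁻ a in Set.Icc (1 / 2 : ℝ) 4 ×ˢ Set.Icc (1 / 2 : ℝ) 4,
          power μ ((t * (ellipseGauge a (τ₁ - φ) / ellipseGauge a (τ - φ))) • circlePoint τ) := by
        congr 1; ext φ
        refine lintegral_lintegral_swap (Measurable.aemeasurable ?_)
        exact (measurable_power μ).comp (by fun_prop)
    _ = ∫⁻ τ in Set.Ioc 0 (2 * Real.pi), ∫⁻ φ in Set.Ioc 0 Real.pi,
        ∫⁻ a in Set.Icc (1 / 2 : ℝ) 4 ×ˢ Set.Icc (1 / 2 : ℝ) 4,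
          power μ ((t * (ellipseGauge a (τ₁ - φ) / ellipseGauge a (τ - φ))) • circlePoint τ) := by
        refine lintegral_lintegral_swap (Measurable.aemeasurable ?_)
        refine Measurable.lintegral_prod_right' (f := fun q : (ℝ × ℝ) × (ℝ × ℝ) =>
          power μ ((t * (ellipseGauge q.2 (τ₁ - q.1.1) / ellipseGauge q.2 (q.1.2 - q.1.1))) •
            circlePoint q.1.2)) ?_
        exact (measurable_power μ).comp (by fun_prop)
    _ ≤ ∫⁻ τ in Set.Ioc 0 (2 * Real.pi), ∫⁻ φ in Set.Ioc 0 Real.pi, ENNReal.ofReal 65536 *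
        N (|Real.sin (τ₁ + τ - 2 * φ)| * |Real.sin (τ₁ - τ)|) τ := by
        refine lintegral_mono_ae (ae_restrict_of_ae ?_)
        filter_upwards [ae_sin_ne_zero (f := fun τ => τ₁ - τ) (fun x y h => by simpa using h)]
          with τ hτ
        refine lintegral_mono_ae (ae_restrict_of_ae ?_)
        filter_upwards [ae_sin_ne_zero (f := fun φ => τ₁ + τ - 2 * φ)
          (fun x y h => by simpa using h)] with φ hφ
        exact setLIntegral_power_ellipse_le μ t τ₁ τ φ hτ hφ
    -- Shifting `φ` by `(τ₁ + τ) / 2` frees the first sine from `τ`.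
    _ = ENNReal.ofReal 65536 * ∫⁻ τ in Set.Ioc 0 (2 * Real.pi), ∫⁻ φ in Set.Ioc 0 Real.pi,
        N (|Real.sin (2 * φ)| * |Real.sin (τ₁ - τ)|) τ := by
        simp_rw [lintegral_const_mul' _ _ ENNReal.ofReal_ne_top]
        congr 2; ext τ
        have hper : Function.Periodic (fun φ => N (|Real.sin (2 * φ)| * |Real.sin (τ₁ - τ)|) τ)
            Real.pi := by
          intro φ
          simp only
          rw [mul_add, Real.sin_add_two_pi]
        rw [← periodic_setLIntegral_Ioc_add hper hπ (-((τ₁ + τ) / 2))]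
        congr 1; ext φ
        rw [← abs_neg (Real.sin (2 * (φ + _))), ← Real.sin_neg]
        ring_nf
    _ = ENNReal.ofReal 65536 * ∫⁻ φ in Set.Ioc 0 Real.pi, ∫⁻ τ in Set.Ioc 0 (2 * Real.pi),
        N (|Real.sin (2 * φ)| * |Real.sin (τ₁ - τ)|) τ := by
        rw [lintegral_lintegral_swap]
        refine Measurable.aemeasurable ?_
        exact measurable_normalizedSliceEnergy μ t (by fun_prop) (by fun_prop)
    _ = ENNReal.ofReal 65536 * ∫⁻ φ in Set.Ioc 0 Real.pi,
        2 * ∫⁻ τ in Set.Ioc (-(Real.pi / 2)) (Real.pi / 2),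
        N (|Real.sin (2 * φ)| * |Real.sin τ|) (τ₁ + τ) := by
        congr 2; ext φ
        have hper : Function.Periodic (fun τ => N (|Real.sin (2 * φ)| * |Real.sin τ|) (τ₁ + τ))
            Real.pi := by
          intro τ
          simp only
          rw [← add_assoc, hNπ, Real.sin_add_pi, abs_neg]
        have hper2 : Function.Periodic (fun τ => N (|Real.sin (2 * φ)| * |Real.sin τ|) (τ₁ + τ))
            (2 * Real.pi) := by
          simpa using hper.nsmul 2
        rw [← periodic_setLIntegral_Ioc_two_mul hper hπ,
          ← periodic_setLIntegral_Ioc_add hper2 (by positivity) (-τ₁)]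
        congr 1; ext τ
        rw [← abs_neg (Real.sin (τ + _)), ← Real.sin_neg]
        ring_nf
    _ ≤ ENNReal.ofReal 65536 * ∫⁻ φ in Set.Ioc 0 Real.pi,
        2 * ENNReal.ofReal (K₁ * |Real.sin (2 * φ)| ^ ((α - 5) / 4) / t) := by
        gcongr with φ
        rcases eq_or_ne (Real.sin (2 * φ)) 0 with h0 | h0
        -- When `sin 2φ = 0` the weight is `1 / 0 = 0`.
        · simp [h0, hN, normalizedSliceEnergy]
        · exact h₁ μ hμ t _ τ₁ ht (abs_pos.2 h0) (Real.abs_sin_le_one _)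
    _ = ENNReal.ofReal 65536 * (ENNReal.ofReal (2 * K₁ / t) * ∫⁻ φ in Set.Ioc 0 Real.pi,
        ENNReal.ofReal (|Real.sin (2 * φ)| ^ ((α - 5) / 4))) := by
        congr 1
        rw [← lintegral_const_mul' (ENNReal.ofReal (2 * K₁ / t)) _ ENNReal.ofReal_ne_top]
        refine lintegral_congr fun φ => ?_
        rw [← ENNReal.ofReal_mul (by positivity), ← ENNReal.ofReal_ofNat,
          ← ENNReal.ofReal_mul (by positivity)]
        ring_nf
    _ ≤ ENNReal.ofReal 65536 * (ENNReal.ofReal (2 * K₁ / t) * ENNReal.ofReal K₂) := by gcongr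
    _ = _ := by
        rw [← ENNReal.ofReal_mul (by positivity), ← ENNReal.ofReal_mul (by positivity)]
        ring_nf

/-! ### Eccentric anomaly versus polar angle. -/

theorem periodic_setLIntegral_Ioo_pi {g : ℝ → ℝ≥0∞} (hg : Function.Periodic g (2 * Real.pi)) :
    ∫⁻ x in Set.Ioo (-Real.pi) Real.pi, g x = ∫⁻ x in Set.Ioc 0 (2 * Real.pi), g x := by
  have h := periodic_setLIntegral_Ioc_eq hg Real.two_pi_pos (-Real.pi) 0
  rw [zero_add, show -Real.pi + 2 * Real.pi = Real.pi by ring] at h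
  rw [← h, setLIntegral_congr Ioo_ae_eq_Ioc]

theorem ellipseGauge_polar (a : ℝ × ℝ) {r : ℝ} (hr : 0 ≤ r) (τ : ℝ) :
    √((r * Real.cos τ / a.1) ^ 2 + (r * Real.sin τ / a.2) ^ 2) = r * ellipseGauge a τ := by
  rw [ellipseGauge, ← Real.sqrt_sq hr, ← Real.sqrt_mul (sq_nonneg r), Real.sqrt_sq hr]
  ring_nf

theorem lintegral_comp_prod_mul_left {g : ℝ × ℝ → ℝ≥0∞} (hg : Measurable g) {a : ℝ × ℝ}
    (h1 : 0 < a.1) (h2 : 0 < a.2) :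
    ∫⁻ x : ℝ × ℝ, g (a.1 * x.1, a.2 * x.2) =
      ENNReal.ofReal a.1⁻¹ * (ENNReal.ofReal a.2⁻¹ * ∫⁻ x, g x) := by
  have hm : Measurable fun x => ∫⁻ y, g (x, y) := hg.lintegral_prod_right'
  rw [Measure.volume_eq_prod, lintegral_prod _ (by fun_prop), lintegral_prod _ hg.aemeasurable,
    ← lintegral_const_mul' _ _ ENNReal.ofReal_ne_top,
    ← lintegral_comp_mul_left (g := fun x => ENNReal.ofReal a.2⁻¹ * ∫⁻ y, g (x, y))
      (by fun_prop) h1]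
  refine lintegral_congr fun x => ?_
  exact lintegral_comp_mul_left (g := fun y => g (a.1 * x, y)) (by fun_prop) h2

/-- The parametrization of an ellipse by the eccentric anomaly is comparable to that by the polar
angle. -/
theorem lintegral_ellipse_le_lintegral_polar {h : ℝ × ℝ → ℝ≥0∞} (hh : Measurable h) {a : ℝ × ℝ}
    (ha : a ∈ Set.Icc (1 / 2 : ℝ) 4 ×ˢ Set.Icc (1 / 2 : ℝ) 4) :
    ∫⁻ θ in Set.Ioo (-Real.pi) Real.pi, h (a.1 * Real.cos θ, a.2 * Real.sin θ) ≤
      ENNReal.ofReal 256 * ∫⁻ τ in Set.Ioo (-Real.pi) Real.pi,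
        h ((ellipseGauge a τ)⁻¹ * Real.cos τ, (ellipseGauge a τ)⁻¹ * Real.sin τ) := by
  have h1 : 0 < a.1 := by linarith [ha.1.1]
  have h2 : 0 < a.2 := by linarith [ha.2.1]
  set N : ℝ × ℝ → ℝ := fun y => √((y.1 / a.1) ^ 2 + (y.2 / a.2) ^ 2) with hN
  have hNm : Measurable N := by fun_prop
  -- `h` on the ellipse is extended, constant along rays, to the shell between the ellipse and its
  -- double. Integrating `g` in dilated and in ordinary polar coordinates compares the two
  -- parametrizations without differentiating the angle.
  set g : ℝ × ℝ → ℝ≥0∞ := (N ⁻¹' Set.Icc 1 2).indicator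
    fun y => h ((N y)⁻¹ * y.1, (N y)⁻¹ * y.2) with hg
  have hgm : Measurable g := Measurable.indicator (by fun_prop) (hNm measurableSet_Icc)
  have hlow : ∫⁻ θ in Set.Ioo (-Real.pi) Real.pi, h (a.1 * Real.cos θ, a.2 * Real.sin θ) ≤
      ∫⁻ x : ℝ × ℝ, g (a.1 * x.1, a.2 * x.2) := by
    rw [lintegral_polar (by fun_prop)]
    calc ∫⁻ θ in Set.Ioo (-Real.pi) Real.pi, h (a.1 * Real.cos θ, a.2 * Real.sin θ)
        = ∫⁻ _ in Set.Icc (1 : ℝ) 2, ∫⁻ θ in Set.Ioo (-Real.pi) Real.pi,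
          h (a.1 * Real.cos θ, a.2 * Real.sin θ) := by
          rw [setLIntegral_const, Real.volume_Icc]; norm_num
      _ ≤ ∫⁻ r in Set.Icc (1 : ℝ) 2, ∫⁻ τ in Set.Ioo (-Real.pi) Real.pi,
          ENNReal.ofReal r * g (a.1 * (r * Real.cos τ), a.2 * (r * Real.sin τ)) := by
          refine setLIntegral_mono' measurableSet_Icc fun r hr => lintegral_mono fun τ => ?_
          have hr0 : 0 < r := by linarith [hr.1]
          have e : N (a.1 * (r * Real.cos τ), a.2 * (r * Real.sin τ)) = r := by
            simp only [hN]
            rw [mul_div_cancel_left₀ _ h1.ne', mul_div_cancel_left₀ _ h2.ne', mul_pow, mul_pow,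
              ← mul_add, Real.cos_sq_add_sin_sq, mul_one, Real.sqrt_sq hr0.le]
          have hmem : (a.1 * (r * Real.cos τ), a.2 * (r * Real.sin τ)) ∈ N ⁻¹' Set.Icc 1 2 := by
            rw [Set.mem_preimage, e]; exact hr
          simp only [hg]
          rw [Set.indicator_of_mem hmem, e]
          simp only
          have e1 : r⁻¹ * (a.1 * (r * Real.cos τ)) = a.1 * Real.cos τ := by field_simp
          have e2 : r⁻¹ * (a.2 * (r * Real.sin τ)) = a.2 * Real.sin τ := by field_simp
          rw [e1, e2]
          apply le_mul_of_one_le_left'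
          rw [← ENNReal.ofReal_one]
          exact ENNReal.ofReal_le_ofReal hr.1
      _ ≤ _ := lintegral_mono_set fun r hr => by
          simp only [Set.mem_Ioi]; linarith [hr.1]
  have hup : ∫⁻ x, g x ≤ ENNReal.ofReal 64 * ∫⁻ τ in Set.Ioo (-Real.pi) Real.pi,
        h ((ellipseGauge a τ)⁻¹ * Real.cos τ, (ellipseGauge a τ)⁻¹ * Real.sin τ) := by
    rw [lintegral_polar hgm]
    calc _ ≤ ∫⁻ r in Set.Ioi 0, (Set.Icc (0 : ℝ) 8).indicator (fun _ => ENNReal.ofReal 8 *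
          ∫⁻ τ in Set.Ioo (-Real.pi) Real.pi,
          h ((ellipseGauge a τ)⁻¹ * Real.cos τ, (ellipseGauge a τ)⁻¹ * Real.sin τ)) r := by
          refine setLIntegral_mono' measurableSet_Ioi fun r hr => ?_
          have hr0 : 0 < r := hr
          have e : ∀ τ, N (r * Real.cos τ, r * Real.sin τ) = r * ellipseGauge a τ := fun τ =>
            ellipseGauge_polar a hr0.le τ
          -- The gauge is at least `1 / 4`, so the shell lies in radius at most 8.
          by_cases hr8 : r ≤ 8
          · rw [Set.indicator_of_mem (show r ∈ Set.Icc 0 8 from ⟨hr0.le, hr8⟩),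
              ← lintegral_const_mul' _ _ ENNReal.ofReal_ne_top]
            refine lintegral_mono fun τ => ?_
            refine mul_le_mul' (ENNReal.ofReal_le_ofReal hr8) ?_
            simp only [hg]
            by_cases hm : (r * Real.cos τ, r * Real.sin τ) ∈ N ⁻¹' Set.Icc 1 2
            · rw [Set.indicator_of_mem hm, e]
              simp only
              have hG : 0 < ellipseGauge a τ := by linarith [(ellipseGauge_mem_Icc ha τ).1]
              have e1 : (r * ellipseGauge a τ)⁻¹ * (r * Real.cos τ) =
                (ellipseGauge a τ)⁻¹ * Real.cos τ := by field_simp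
              have e2 : (r * ellipseGauge a τ)⁻¹ * (r * Real.sin τ) =
                (ellipseGauge a τ)⁻¹ * Real.sin τ := by field_simp
              rw [e1, e2]
            · rw [Set.indicator_of_notMem hm]; exact zero_le
          · have : ∀ τ, g (r * Real.cos τ, r * Real.sin τ) = 0 := by
              intro τ
              simp only [hg]
              apply Set.indicator_of_notMem
              rw [Set.mem_preimage, e]
              rintro ⟨-, h3⟩
              nlinarith [(ellipseGauge_mem_Icc ha τ).1]
            simp [this]
      _ ≤ _ := by
          refine (setLIntegral_le_lintegral _ _).trans ?_
          rw [lintegral_indicator measurableSet_Icc, setLIntegral_const, Real.volume_Icc,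
            mul_right_comm, ← ENNReal.ofReal_mul (by norm_num)]
          norm_num
  have hinv : ∀ {x : ℝ}, 1 / 2 ≤ x → x⁻¹ ≤ 2 := fun {x} hx => by
    rw [inv_le_comm₀ (by linarith) two_pos]; linarith
  calc _ ≤ _ := hlow
    _ = ENNReal.ofReal a.1⁻¹ * (ENNReal.ofReal a.2⁻¹ * ∫⁻ x, g x) :=
        lintegral_comp_prod_mul_left hgm h1 h2
    _ ≤ ENNReal.ofReal 2 * (ENNReal.ofReal 2 * (ENNReal.ofReal 64 *
          ∫⁻ τ in Set.Ioo (-Real.pi) Real.pi,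
        h ((ellipseGauge a τ)⁻¹ * Real.cos τ, (ellipseGauge a τ)⁻¹ * Real.sin τ))) := by
        gcongr
        · exact hinv ha.1.1
        · exact hinv ha.2.1
    _ = _ := by
        rw [← mul_assoc, ← mul_assoc, ← ENNReal.ofReal_mul (by norm_num),
          ← ENNReal.ofReal_mul (by norm_num)]
        norm_num

theorem circlePoint_periodic : Function.Periodic circlePoint (2 * Real.pi) := fun τ => by
  simp [circlePoint]

theorem ellipseGauge_periodic (a : ℝ × ℝ) : Function.Periodic (ellipseGauge a) (2 * Real.pi) :=
  fun τ => by simp [ellipseGauge]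

theorem ellipsePoint_circlePoint (a : ℝ × ℝ) (φ θ : ℝ) :
    ellipsePoint a φ (circlePoint θ) = framePoint φ (a.1 * Real.cos θ, a.2 * Real.sin θ) := by
  ext i
  fin_cases i <;> simp [ellipsePoint, rotate, dilate, circlePoint, framePoint] <;> ring

theorem lintegral_ellipsePoint_le {h : Plane → ℝ≥0∞} (hh : Measurable h) {a : ℝ × ℝ}
    (ha : a ∈ Set.Icc (1 / 2 : ℝ) 4 ×ˢ Set.Icc (1 / 2 : ℝ) 4) (φ : ℝ) :
    ∫⁻ θ in Set.Ioc 0 (2 * Real.pi), h (ellipsePoint a φ (circlePoint θ)) ≤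
      ENNReal.ofReal 256 * ∫⁻ τ in Set.Ioc 0 (2 * Real.pi),
        h ((ellipseGauge a (τ - φ))⁻¹ • circlePoint τ) := by
  have hm : Measurable fun x => h (framePoint φ x) := by fun_prop
  have key := lintegral_ellipse_le_lintegral_polar hm ha
  simp only [framePoint_polar] at key
  have p1 : Function.Periodic (fun θ => h (ellipsePoint a φ (circlePoint θ))) (2 * Real.pi) :=
    fun θ => by simp only [circlePoint_periodic θ]
  have p2 : Function.Periodic (fun τ => h ((ellipseGauge a τ)⁻¹ • circlePoint (φ + τ)))
      (2 * Real.pi) := fun τ => by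
    simp only [ellipseGauge_periodic a τ, ← add_assoc, circlePoint_periodic (φ + τ)]
  rw [← periodic_setLIntegral_Ioo_pi p1]
  simp only [ellipsePoint_circlePoint]
  refine key.trans (le_of_eq ?_)
  rw [periodic_setLIntegral_Ioo_pi p2, ← periodic_setLIntegral_Ioc_add p2 Real.two_pi_pos (-φ)]
  congr 1
  refine lintegral_congr fun τ => ?_
  rw [← sub_eq_add_neg, add_sub_cancel]

/-! ### Energy of dimension one. -/

/-- The case `ε = 0` with a square box gives `O(A^(2-α))` on the disc of radius `A`. Averaging over
`A` in `[t, 2t]` replaces a dyadic sum and leaves the integral of `A ^ (-α)`, convergent since `α >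
1`. -/
theorem SquareFrostman.lintegral_power_circle_lt_top {μ : Measure Plane} {α C : ℝ}
    (hμ : SquareFrostman μ α C) :
    ∫⁻ t in Set.Ioi (1 / 2 : ℝ), ∫⁻ τ in Set.Ioc 0 (2 * Real.pi), power μ (t • circlePoint τ) <
      ∞ := by
  obtain ⟨K, hK, h⟩ := exists_setLIntegral_power_le α C le_rfl zero_le_one
  have := hμ.isFiniteMeasure
  have hα := hμ.one_lt
  set e : ℝ → ℝ≥0∞ := fun t => ∫⁻ τ in Set.Ioo (-Real.pi) Real.pi, power μ (t • circlePoint τ)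
    with he
  have hem : Measurable e := by
    refine Measurable.lintegral_prod_right'
      (f := fun q : ℝ × ℝ => power μ (q.1 • circlePoint q.2)) ?_
    exact (measurable_power μ).comp (by fun_prop)
  have hcirc : ∀ t, ∫⁻ τ in Set.Ioc 0 (2 * Real.pi), power μ (t • circlePoint τ) = e t := fun t =>
    (periodic_setLIntegral_Ioo_pi fun τ => by simp only [circlePoint_periodic τ]).symm
  simp_rw [hcirc]
  have hball : ∀ A : ℝ, 0 < A → ∫⁻ t in Set.Ioc 0 A, ENNReal.ofReal t * e t ≤
      ENNReal.ofReal (K * A ^ (2 - α)) := by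
    intro A hA
    have hb := h μ hμ 0 0 A A hA le_rfl
    rw [Real.rpow_zero, mul_one] at hb
    refine le_trans ?_ hb
    set box : Set (ℝ × ℝ) := Set.Icc (-A) A ×ˢ Set.Icc (-A) A
    have hbox : MeasurableSet box := measurableSet_Icc.prod measurableSet_Icc
    have hpm : Measurable fun x => power μ (0 + framePoint 0 x) :=
      (measurable_power μ).comp (by fun_prop)
    rw [← lintegral_indicator hbox, lintegral_polar (hpm.indicator hbox)]
    calc ∫⁻ t in Set.Ioc 0 A, ENNReal.ofReal t * e t
        ≤ ∫⁻ r in Set.Ioc 0 A, ∫⁻ τ in Set.Ioo (-Real.pi) Real.pi, ENNReal.ofReal r *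
          box.indicator (fun x => power μ (0 + framePoint 0 x))
            (r * Real.cos τ, r * Real.sin τ) := by
          refine setLIntegral_mono' measurableSet_Ioc fun r hr => le_of_eq ?_
          simp only [he]
          rw [← lintegral_const_mul' _ _ ENNReal.ofReal_ne_top]
          refine lintegral_congr fun τ => ?_
          have hmem : (r * Real.cos τ, r * Real.sin τ) ∈ box := by
            have hc : ∀ c : ℝ, |c| ≤ 1 → r * c ∈ Set.Icc (-A) A := fun c hc => by
              rw [Set.mem_Icc, ← abs_le, abs_mul, abs_of_pos hr.1]
              nlinarith [hr.1, hr.2, abs_nonneg c]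
            exact ⟨hc _ (Real.abs_cos_le_one τ), hc _ (Real.abs_sin_le_one τ)⟩
          rw [Set.indicator_of_mem hmem, framePoint_polar, zero_add, zero_add]
      _ ≤ _ := lintegral_mono_set fun r hr => hr.1
  set Q : Set (ℝ × ℝ) := {q | q.1 ≤ q.2 ∧ q.2 ≤ 2 * q.1} with hQ
  have hQm : MeasurableSet Q :=
    (measurableSet_le measurable_fst measurable_snd).inter
      (measurableSet_le measurable_snd (by fun_prop))
  set Φ : ℝ × ℝ → ℝ≥0∞ := Q.indicator fun q =>
    ENNReal.ofReal (4 * (q.2 ^ 2)⁻¹) * (ENNReal.ofReal q.1 * e q.1) with hΦ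
  have hΦm : Measurable Φ := Measurable.indicator (by fun_prop) hQm
  have hpt : ∀ t ∈ Set.Ioi (1 / 2 : ℝ), e t ≤ ∫⁻ A in Set.Ioi (1 / 2 : ℝ), Φ (t, A) := by
    intro t ht
    have ht2 : 1 / 2 < t := ht
    have ht0 : 0 < t := by linarith
    calc e t = ∫⁻ _ in Set.Icc t (2 * t), ENNReal.ofReal t⁻¹ * e t := by
          rw [setLIntegral_const, Real.volume_Icc, mul_right_comm,
            ← ENNReal.ofReal_mul (by positivity)]
          have : t⁻¹ * (2 * t - t) = 1 := by field_simp; ring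
          rw [this, ENNReal.ofReal_one, one_mul]
      _ ≤ ∫⁻ A in Set.Icc t (2 * t), Φ (t, A) := by
          refine setLIntegral_mono' measurableSet_Icc fun A hA => ?_
          have hA0 : 0 < A := by linarith [hA.1]
          rw [hΦ, Set.indicator_of_mem (show (t, A) ∈ Q from hA), ← mul_assoc,
            ← ENNReal.ofReal_mul (by positivity)]
          gcongr
          rw [← one_div, ← div_eq_mul_inv, div_mul_eq_mul_div, div_le_div_iff₀ ht0 (by positivity)]
          nlinarith [hA.2]
      _ ≤ _ := lintegral_mono_set fun A hA => by
          simp only [Set.mem_Ioi]; linarith [hA.1]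
  calc ∫⁻ t in Set.Ioi (1 / 2 : ℝ), e t
      ≤ ∫⁻ t in Set.Ioi (1 / 2 : ℝ), ∫⁻ A in Set.Ioi (1 / 2 : ℝ), Φ (t, A) :=
        setLIntegral_mono' measurableSet_Ioi hpt
    _ = ∫⁻ A in Set.Ioi (1 / 2 : ℝ), ∫⁻ t in Set.Ioi (1 / 2 : ℝ), Φ (t, A) :=
        lintegral_lintegral_swap hΦm.aemeasurable
    _ ≤ ∫⁻ A in Set.Ioi (1 / 2 : ℝ), ENNReal.ofReal (4 * K) * ENNReal.ofReal (A ^ (-α)) := by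
        refine setLIntegral_mono' measurableSet_Ioi fun A hA => ?_
        have hA2 : 1 / 2 < A := hA
        have hA0 : 0 < A := by linarith
        calc ∫⁻ t in Set.Ioi (1 / 2 : ℝ), Φ (t, A)
            ≤ ∫⁻ t in Set.Ioi (1 / 2 : ℝ), (Set.Ioc 0 A).indicator
              (fun t => ENNReal.ofReal (4 * (A ^ 2)⁻¹) * (ENNReal.ofReal t * e t)) t := by
              refine setLIntegral_mono' measurableSet_Ioi fun t ht => ?_
              have ht2 : 1 / 2 < t := ht
              by_cases hm : (t, A) ∈ Q
              · rw [hΦ, Set.indicator_of_mem hm, Set.indicator_of_mem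
                  (show t ∈ Set.Ioc 0 A from ⟨by linarith, hm.1⟩)]
              · rw [hΦ, Set.indicator_of_notMem hm]; exact zero_le
          _ ≤ ENNReal.ofReal (4 * (A ^ 2)⁻¹) * ∫⁻ t in Set.Ioc 0 A, ENNReal.ofReal t * e t := by
              refine (setLIntegral_le_lintegral _ _).trans (le_of_eq ?_)
              rw [lintegral_indicator measurableSet_Ioc,
                lintegral_const_mul' _ _ ENNReal.ofReal_ne_top]
          _ ≤ ENNReal.ofReal (4 * (A ^ 2)⁻¹) * ENNReal.ofReal (K * A ^ (2 - α)) := by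
              gcongr
              exact hball A hA0
          _ = _ := by
              rw [← ENNReal.ofReal_mul (by positivity), ← ENNReal.ofReal_mul (by positivity)]
              congr 1
              have : A ^ (2 - α) = A ^ 2 * A ^ (-α) := by
                rw [← Real.rpow_natCast, ← Real.rpow_add hA0]; push_cast; ring_nf
              rw [this]
              field_simp
    _ < ∞ := by
        rw [lintegral_const_mul' _ _ ENNReal.ofReal_ne_top,
          setLIntegral_Ioi_rpow (by linarith) (by norm_num)]
        exact ENNReal.mul_lt_top ENNReal.ofReal_lt_top ENNReal.ofReal_lt_top

/-! ### Expanding the square and conclusion. -/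

/-- The mean square of the Fourier transform over the ellipse with axis ratio and orientation given
by `a` and `φ` through the point with polar coordinates `z.2` and `z.1`. -/
def ellipseThroughMean (μ : Measure Plane) (z : ℝ × ℝ) (φ : ℝ) (a : ℝ × ℝ) : ℝ≥0∞ :=
  ∫⁻ τ in Set.Ioc 0 (2 * Real.pi),
    power μ ((z.2 * (ellipseGauge a (z.1 - φ) / ellipseGauge a (τ - φ))) • circlePoint τ)

theorem measurable_ellipseThroughMean (μ : Measure Plane) [IsFiniteMeasure μ] {β : Type*}
    [MeasurableSpace β] {f k : β → ℝ × ℝ} {g : β → ℝ} (hf : Measurable f) (hg : Measurable g)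
    (hk : Measurable k) : Measurable fun x => ellipseThroughMean μ (f x) (g x) (k x) := by
  unfold ellipseThroughMean
  refine Measurable.lintegral_prod_right' (f := fun q : β × ℝ =>
      power μ (((f q.1).2 * (ellipseGauge (k q.1) ((f q.1).1 - g q.1) /
        ellipseGauge (k q.1) (q.2 - g q.1))) • circlePoint q.2)) ?_
  exact (measurable_power μ).comp (by fun_prop)

/-- One factor of the squared mean is opened, and for each direction `τ₁` the dilation `t` is
replaced by the distance `r` of its point from the origin. -/
theorem mattilaIntegral_le (μ : Measure Plane) [IsFiniteMeasure μ] {a : ℝ × ℝ}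
    (ha : a ∈ Set.Icc (1 / 2 : ℝ) 4 ×ˢ Set.Icc (1 / 2 : ℝ) 4) (φ : ℝ) :
    mattilaIntegral μ a φ ≤ ENNReal.ofReal 262144 *
      ∫⁻ τ₁ in Set.Ioc 0 (2 * Real.pi), ∫⁻ r in Set.Ioi (1 / 2 : ℝ),
        ENNReal.ofReal r * power μ (r • circlePoint τ₁) *
        ∫⁻ τ in Set.Ioc 0 (2 * Real.pi),
          power μ ((r * (ellipseGauge a (τ₁ - φ) / ellipseGauge a (τ - φ))) • circlePoint τ) := by
  set m : ℝ → ℝ≥0∞ := fun t => ∫⁻ τ in Set.Ioc 0 (2 * Real.pi),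
    power μ ((t * (ellipseGauge a (τ - φ))⁻¹) • circlePoint τ) with hm
  have hpm := measurable_power μ
  have hmm : Measurable m := by
    refine Measurable.lintegral_prod_right' (f := fun q : ℝ × ℝ =>
      power μ ((q.1 * (ellipseGauge a (q.2 - φ))⁻¹) • circlePoint q.2)) ?_
    exact hpm.comp (by fun_prop)
  have hmean : ∀ t, ellipseMean μ a φ t ≤ ENNReal.ofReal 256 * m t := by
    intro t
    have := lintegral_ellipsePoint_le (h := fun x => power μ (t • x)) (by fun_prop) ha φ
    simp only [smul_smul] at this
    exact this
  calc mattilaIntegral μ a φ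
      ≤ ∫⁻ t in Set.Ioi (1 : ℝ), (ENNReal.ofReal 256 * m t) ^ 2 * ENNReal.ofReal t := by
        unfold mattilaIntegral
        gcongr with t
        exact hmean t
    _ = ENNReal.ofReal 65536 * ∫⁻ t in Set.Ioi (1 : ℝ), ∫⁻ τ₁ in Set.Ioc 0 (2 * Real.pi),
          ENNReal.ofReal t * power μ ((t * (ellipseGauge a (τ₁ - φ))⁻¹) • circlePoint τ₁) *
            m t := by
        rw [← lintegral_const_mul' _ _ ENNReal.ofReal_ne_top]
        refine lintegral_congr fun t => ?_
        rw [lintegral_mul_const _ (by fun_prop), lintegral_const_mul' _ _ ENNReal.ofReal_ne_top,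
          mul_pow, ← ENNReal.ofReal_pow (by norm_num), sq (m t)]
        norm_num
        ring
    _ = ENNReal.ofReal 65536 * ∫⁻ τ₁ in Set.Ioc 0 (2 * Real.pi), ∫⁻ t in Set.Ioi (1 : ℝ),
          ENNReal.ofReal t * power μ ((t * (ellipseGauge a (τ₁ - φ))⁻¹) • circlePoint τ₁) *
            m t := by
        rw [lintegral_lintegral_swap]
        exact Measurable.aemeasurable (by unfold Function.uncurry; fun_prop)
    _ ≤ ENNReal.ofReal 65536 * ∫⁻ τ₁ in Set.Ioc 0 (2 * Real.pi), ENNReal.ofReal 4 *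
          ∫⁻ r in Set.Ioi (1 / 2 : ℝ), ENNReal.ofReal r * power μ (r • circlePoint τ₁) *
        ∫⁻ τ in Set.Ioc 0 (2 * Real.pi),
          power μ ((r * (ellipseGauge a (τ₁ - φ) / ellipseGauge a (τ - φ))) • circlePoint τ) := by
        gcongr with τ₁
        -- The substitution is `t = G r`. As `G ≤ 2`, the range `t > 1` becomes a subset of `r > 1 /
        -- 2`, and `dt` and the weight `t` each cost a factor `G`, together at most 4.
        obtain ⟨hG1, hG2⟩ := ellipseGauge_mem_Icc ha (τ₁ - φ)
        set G := ellipseGauge a (τ₁ - φ) with hG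
        have hG0 : 0 < G := by linarith
        have e : ∀ t, ENNReal.ofReal t * power μ ((t * G⁻¹) • circlePoint τ₁) * m t =
            (fun r => ENNReal.ofReal (G * r) * power μ (r • circlePoint τ₁) * m (G * r))
              (G⁻¹ * t) := by
          intro t
          simp only
          rw [mul_inv_cancel_left₀ hG0.ne', mul_comm t]
        simp_rw [e]
        rw [setLIntegral_Ioi_comp_mul_left (g := fun r =>
          ENNReal.ofReal (G * r) * power μ (r • circlePoint τ₁) * m (G * r)) (by fun_prop)
          (inv_pos.2 hG0), inv_inv, mul_one, ← lintegral_const_mul' _ _ ENNReal.ofReal_ne_top,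
          ← lintegral_const_mul' _ _ ENNReal.ofReal_ne_top]
        have hsub : Set.Ioi G⁻¹ ⊆ Set.Ioi (1 / 2 : ℝ) := Set.Ioi_subset_Ioi (by
          rw [one_div]; gcongr)
        refine (lintegral_mono_set hsub).trans (lintegral_mono fun r => ?_)
        have e2 : m (G * r) = ∫⁻ τ in Set.Ioc 0 (2 * Real.pi),
            power μ ((r * (G / ellipseGauge a (τ - φ))) • circlePoint τ) := by
          refine lintegral_congr fun τ => ?_
          congr 2
          ring
        simp only
        rw [e2, ENNReal.ofReal_mul hG0.le, mul_assoc, mul_assoc, ← mul_assoc,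
          ← ENNReal.ofReal_mul hG0.le, mul_assoc (ENNReal.ofReal r)]
        gcongr
        nlinarith
    _ = _ := by
        rw [lintegral_const_mul' _ _ ENNReal.ofReal_ne_top, ← mul_assoc,
          ← ENNReal.ofReal_mul (by norm_num)]
        norm_num

theorem SquareFrostman.lintegral_mattilaIntegral_lt_top {μ : Measure Plane} {α C : ℝ}
    (hμ : SquareFrostman μ α C) :
    ∫⁻ φ in Set.Ioc 0 Real.pi, ∫⁻ a in Set.Icc (1 / 2 : ℝ) 4 ×ˢ Set.Icc (1 / 2 : ℝ) 4,
      mattilaIntegral μ a φ < ∞ := by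
  obtain ⟨K, hK, h⟩ := exists_lintegral_ellipses_le α C
  have := hμ.isFiniteMeasure
  have hpm := measurable_power μ
  set Q : Set (ℝ × ℝ) := Set.Icc (1 / 2 : ℝ) 4 ×ˢ Set.Icc (1 / 2 : ℝ) 4 with hQ
  have hQm : MeasurableSet Q := measurableSet_Icc.prod measurableSet_Icc
  set ν : Measure (ℝ × ℝ) := (volume.restrict (Set.Ioc 0 (2 * Real.pi))).prod
    (volume.restrict (Set.Ioi (1 / 2 : ℝ))) with hν
  set b : ℝ × ℝ → ℝ≥0∞ := fun z => ENNReal.ofReal z.2 * power μ (z.2 • circlePoint z.1) with hb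
  have hbm : Measurable b := by fun_prop
  calc ∫⁻ φ in Set.Ioc 0 Real.pi, ∫⁻ a in Q, mattilaIntegral μ a φ
      ≤ ∫⁻ φ in Set.Ioc 0 Real.pi, ∫⁻ a in Q, ENNReal.ofReal 262144 *
          ∫⁻ z, b z * ellipseThroughMean μ z φ a ∂ν := by
        refine lintegral_mono fun φ => setLIntegral_mono' hQm fun a ha => ?_
        refine (mattilaIntegral_le μ ha φ).trans (le_of_eq ?_)
        have hm : Measurable fun z => b z * ellipseThroughMean μ z φ a :=
          hbm.mul (measurable_ellipseThroughMean μ measurable_id measurable_const measurable_const)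
        rw [hν, lintegral_prod _ hm.aemeasurable]
        rfl
    _ = ENNReal.ofReal 262144 * ∫⁻ φ in Set.Ioc 0 Real.pi, ∫⁻ z, (∫⁻ a in Q,
          b z * ellipseThroughMean μ z φ a) ∂ν := by
        rw [← lintegral_const_mul' _ _ ENNReal.ofReal_ne_top]
        refine lintegral_congr fun φ => ?_
        have hm : Measurable fun q : (ℝ × ℝ) × (ℝ × ℝ) =>
            b q.2 * ellipseThroughMean μ q.2 φ q.1 :=
          (hbm.comp measurable_snd).mul
            (measurable_ellipseThroughMean μ measurable_snd measurable_const measurable_fst)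
        rw [lintegral_const_mul' _ _ ENNReal.ofReal_ne_top]
        congr 1
        exact lintegral_lintegral_swap hm.aemeasurable
    _ = ENNReal.ofReal 262144 * ∫⁻ z, (∫⁻ φ in Set.Ioc 0 Real.pi, ∫⁻ a in Q,
          b z * ellipseThroughMean μ z φ a) ∂ν := by
        rw [lintegral_lintegral_swap]
        refine Measurable.aemeasurable ?_
        refine Measurable.lintegral_prod_right' (f := fun q : (ℝ × (ℝ × ℝ)) × (ℝ × ℝ) =>
          b q.1.2 * ellipseThroughMean μ q.1.2 q.1.1 q.2) ?_
        exact (hbm.comp (by fun_prop)).mul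
          (measurable_ellipseThroughMean μ (by fun_prop) (by fun_prop) (by fun_prop))
    _ ≤ ENNReal.ofReal 262144 * ∫⁻ z, ENNReal.ofReal K * power μ (z.2 • circlePoint z.1) ∂ν := by
        refine mul_le_mul_right (lintegral_mono_ae ?_) _
        have hae : ∀ᵐ z ∂ν, z.2 ∈ Set.Ioi (1 / 2 : ℝ) :=
          Measure.quasiMeasurePreserving_snd.ae (ae_restrict_mem measurableSet_Ioi)
        filter_upwards [hae] with z hz
        have hz2 : 1 / 2 < z.2 := hz
        have hz0 : 0 < z.2 := by linarith
        have e : ∀ φ, ∫⁻ a in Q, b z * ellipseThroughMean μ z φ a =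
            b z * ∫⁻ a in Q, ellipseThroughMean μ z φ a := fun φ =>
          lintegral_const_mul _
            (measurable_ellipseThroughMean μ measurable_const measurable_const measurable_id)
        have e' : ∫⁻ φ in Set.Ioc 0 Real.pi, b z * ∫⁻ a in Q, ellipseThroughMean μ z φ a =
            b z * ∫⁻ φ in Set.Ioc 0 Real.pi, ∫⁻ a in Q, ellipseThroughMean μ z φ a := by
          refine lintegral_const_mul _ ?_
          exact Measurable.lintegral_prod_right'
            (f := fun q : ℝ × (ℝ × ℝ) => ellipseThroughMean μ z q.1 q.2)
            (measurable_ellipseThroughMean μ measurable_const measurable_fst measurable_snd)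
        simp_rw [e]
        rw [e']
        refine (mul_le_mul_right (h μ hμ z.2 z.1 hz0) _).trans (le_of_eq ?_)
        simp only [hb]
        -- The radial weight `r` cancels the decay `K / r`.
        rw [mul_right_comm, ← ENNReal.ofReal_mul hz0.le, mul_div_cancel₀ _ hz0.ne']
    _ = ENNReal.ofReal 262144 * (ENNReal.ofReal K * ∫⁻ r in Set.Ioi (1 / 2 : ℝ),
          ∫⁻ τ in Set.Ioc 0 (2 * Real.pi), power μ (r • circlePoint τ)) := by
        rw [lintegral_const_mul' _ _ ENNReal.ofReal_ne_top, hν, lintegral_prod_symm]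
        exact Measurable.aemeasurable (by fun_prop)
    _ < ∞ := ENNReal.mul_lt_top ENNReal.ofReal_lt_top
        (ENNReal.mul_lt_top ENNReal.ofReal_lt_top hμ.lintegral_power_circle_lt_top)

end MattilaEllipse

end

theorem theorem1p3 (E : Set MattilaEllipse.Plane) (hE : E ⊆ MattilaEllipse.unitSquare)
    (α : ℝ) (hα : 1 < α)
    (μ : Measure MattilaEllipse.Plane) (hμ : MattilaEllipse.IsFrostman μ E α)
    (ψ : ℝ × ℝ → ℝ) (hψ : ContDiff ℝ ((⊤ : ℕ∞) : WithTop ℕ∞) ψ)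
    (hψ_one : ∀ a ∈ Set.Icc (1 : ℝ) 2 ×ˢ Set.Icc (1 : ℝ) 2, ψ a = 1)
    (hψ_zero : ∀ a ∉ Set.Icc (1 / 2 : ℝ) 4 ×ˢ Set.Icc (1 / 2 : ℝ) 4, ψ a = 0) :
    ∫⁻ φ in Set.Ioc 0 Real.pi, ∫⁻ a : ℝ × ℝ,
      MattilaEllipse.mattilaIntegral μ a φ * ‖ψ a‖ₑ < ∞ := by
  obtain ⟨C, hC⟩ := hμ.exists_squareFrostman hE hα
  have hfin := hC.lintegral_mattilaIntegral_lt_top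
  set Q : Set (ℝ × ℝ) := Set.Icc (1 / 2 : ℝ) 4 ×ˢ Set.Icc (1 / 2 : ℝ) 4 with hQ
  have hQm : MeasurableSet Q := measurableSet_Icc.prod measurableSet_Icc
  -- Of the cutoff, only its boundedness on the support square matters.
  obtain ⟨M, hM⟩ := (isCompact_Icc.prod isCompact_Icc : IsCompact Q).exists_bound_of_continuousOn
    hψ.continuous.continuousOn
  calc ∫⁻ φ in Set.Ioc 0 Real.pi, ∫⁻ a : ℝ × ℝ, MattilaEllipse.mattilaIntegral μ a φ * ‖ψ a‖ₑ
      ≤ ∫⁻ φ in Set.Ioc 0 Real.pi, ∫⁻ a : ℝ × ℝ,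
          Q.indicator (fun a => MattilaEllipse.mattilaIntegral μ a φ * ENNReal.ofReal M) a := by
        refine lintegral_mono fun φ => lintegral_mono fun a => ?_
        by_cases ha : a ∈ Q
        · rw [Set.indicator_of_mem ha, ← ofReal_norm]
          gcongr
          exact hM a ha
        · simp [hψ_zero a ha]
    _ = (∫⁻ φ in Set.Ioc 0 Real.pi, ∫⁻ a in Q, MattilaEllipse.mattilaIntegral μ a φ) *
          ENNReal.ofReal M := by
        simp_rw [lintegral_indicator hQm, lintegral_mul_const' _ _ ENNReal.ofReal_ne_top]
    _ < ∞ := ENNReal.mul_lt_top hfin ENNReal.ofReal_lt_top
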